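/- Let $s\ge 0$. Consider coordinates $u=(x^1,x^2,y^3,y^4,\zeta^5,\dots,\zeta^{4+2s})$ on an open set $U\subset\mathbb R^{4+2s}$, grouped in two-dimensional shells: shell $0$ is $(x^1,x^2)$, and shell $k$, for $1\le k\le s+1$, is $(u^{2k+1},u^{2k+2})$ (so $(y^3,y^4)$ for $k=1$ and $(\zeta^{2k+1},\zeta^{2k+2})$ for $k\ge 2$). Write $\partial_\mu=\partial/\partial u^\mu$. Take the d-metric ansatz $$\mathbf g=\sum_{i=1,2}\epsilon_i e^{\psi}\,(dx^i)^2+\sum_{k=1}^{s+1}\Big(h_{2k+1}(\mathbf e^{2k+1})^2+h_{2k+2}(\mathbf e^{2k+2})^2\Big),\qquad \epsilon_i=\pm1,$$ $$\mathbf e^{2k+1}=du^{2k+1}+\sum_{\tau\le 2k}{}^{k}n_\tau\,du^\tau,\qquad \mathbf e^{2k+2}=du^{2k+2}+\sum_{\tau\le 2k}{}^{k}w_\tau\,du^\tau,$$ with smooth coefficients, where $\psi=\psi(x^1,x^2)$ and $h_{2k+1},h_{2k+2},{}^{k}n_\tau,{}^{k}w_\tau$ depend only on $u^1,\dots,u^{2k}$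 and $u^{2k+2}$, so that those of shell $k=1$ depend only on $x^1,x^2,y^4$ (Killing symmetry $\partial_3$ of the spacetime part). Assume that $h_{2k+1}$, $h_{2k+2}$ and $\partial_{2k+2}h_{2k+1}$ vanish nowhere. Put $${}^{k}\phi=\ln\left|\frac{\partial_{2k+2}h_{2k+1}}{\sqrt{|h_{2k+1}h_{2k+2}|}}\right|,\qquad {}^{k}\gamma=\partial_{2k+2}\ln\frac{|h_{2k+1}|^{3/2}}{|h_{2k+2}|^{1/2}},$$ $${}^{k}\alpha_\tau=\frac{(\partial_\tau{}^{k}\phi)\,\partial_{2k+2}h_{2k+1}}{2h_{2k+1}},\qquad {}^{k}\beta=\frac{(\partial_{2k+2}{}^{k}\phi)\,\partial_{2k+2}h_{2k+1}}{2h_{2k+1}}.$$ Let $\mathbf e_\alpha$ be the frame dual to the coframe $\mathbf e^\alpha$ (with $\mathbf e^i=dx^i$), with $[\mathbf e_\alpha,\mathbf e_\beta]=W^\gamma_{\alpha\beta}\mathbf e_\gamma$, and let $g_\alpha$ be the diagonal coefficients of $\mathbf g$ in it, $g_{\alpha\beta}=g_\alpha\delta_{\alpha\beta}$. The canonical d-connection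 is $\widehat{\mathbf D}_{\mathbf e_\alpha}\mathbf e_\beta=\widehat\Gamma^\gamma_{\beta\alpha}\mathbf e_\gamma$, where $\widehat\Gamma^\gamma_{\beta\alpha}=0$ unless $\beta,\gamma$ lie in the same shell, and for $\beta,\gamma$ in the same shell (no summation) $$\widehat\Gamma^\gamma_{\beta\alpha}=\tfrac1{2g_\gamma}\big(\mathbf e_\alpha g_{\beta\gamma}+\mathbf e_\beta g_{\alpha\gamma}-\mathbf e_\gamma g_{\beta\alpha}\big)\quad\text{if }\alpha\text{ lies in that shell too},$$ $$\widehat\Gamma^\gamma_{\beta\alpha}=W^\gamma_{\alpha\beta}+\tfrac1{2g_\gamma}\big(\mathbf e_\alpha g_{\beta\gamma}-W^\gamma_{\alpha\beta}g_\gamma-W^\beta_{\alpha\gamma}g_\beta\big)\quad\text{otherwise}.$$ Let $\widehat{\mathbf R}_{\alpha\beta}=\widehat{\mathbf R}^{\tau}{}_{\alpha\beta\tau}$ be its Ricci tensor, where $\widehat{\mathbf R}^{\delta}{}_{\gamma\beta\alpha}$ is the $\mathbf e_\delta$-component of $\mathbf R(\mathbf e_\alpha,\mathbf e_\beta)\mathbf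 e_\gamma$ and $\mathbf R(X,Y)=\widehat{\mathbf D}_X\widehat{\mathbf D}_Y-\widehat{\mathbf D}_Y\widehat{\mathbf D}_X-\widehat{\mathbf D}_{[X,Y]}$, and let $\widehat R=\mathbf g^{\alpha\beta}\widehat{\mathbf R}_{\alpha\beta}$. Let the source be polarized: $\Lambda_0=\Lambda(x^1,x^2)$, and $\Lambda_k$, for $1\le k\le s+1$, depends on the same coordinates as the coefficients of shell $k$; the mixed source $\mathbf\Upsilon^\alpha_\beta$ is diagonal, and its two diagonal entries in shell $k$ equal $\sum_{j\ne k}\Lambda_j$. Then, at every point of $U$, the modified Einstein equations $$\widehat{\mathbf R}_{\alpha\beta}-\tfrac12\mathbf g_{\alpha\beta}\widehat R=\mathbf\Upsilon_{\alpha\beta}\qquad\text{for all }\alpha,\beta,\qquad \mathbf\Upsilon_{\alpha\beta}=\mathbf g_{\alpha\gamma}\mathbf\Upsilon^\gamma_\beta,$$ hold if and only if the following decoupled system holds: $$\epsilon_1\partial_{11}\psi+\epsilon_2\partial_{22}\psi=2e^{\psi}\Lambda_0$$ (the two-dimensional Laplace/d'Alembert operator on $\psi$; in terms of the rescaled source $\widehat\Lambda=e^\psi\Lambda_0$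 it is the Laplace/d'Alembert equation with right-hand side $2\widehat\Lambda(x^1,x^2)$), and, on each shell $1\le k\le s+1$ and for all $\tau\le 2k$, $$(\partial_{2k+2}{}^{k}\phi)(\partial_{2k+2}h_{2k+1})=2h_{2k+1}h_{2k+2}\Lambda_k,$$ $$\partial_{2k+2}^2\,{}^{k}n_\tau+{}^{k}\gamma\,\partial_{2k+2}{}^{k}n_\tau=0,$$ $${}^{k}\beta\,{}^{k}w_\tau-{}^{k}\alpha_\tau=0.$$ -/

import Mathlib

open scoped ContDiff

noncomputable section

namespace JetDecoupling

/-! Coordinates on the `(4 + 2 s)`-dimensional space with `2 + 2 + ... + 2` shell splitting.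
An index is a pair `(k, c)`, where `k` is the shell and `c` the position in the shell:
`(0, 0), (0, 1)` are `x¹, x²`; `(1, 0), (1, 1)` are `y³, y⁴`; and, for `k ≥ 2`,
`(k, 0), (k, 1)` are the jet variables `ζ^(2k+1), ζ^(2k+2)`. -/

/-- Coordinate (and frame) indices; there are `4 + 2 s` of them. -/
abbrev Idx (s : ℕ) : Type := Fin (s + 2) × Fin 2

/-- Coordinate points. -/
abbrev Pt (s : ℕ) : Type := Idx s → ℝ

/-- Scalar functions of all the coordinates. -/
abbrev Field (s : ℕ) : Type := Pt s → ℝ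

/-- Partial derivative of `f` with respect to the coordinate with index `a`. -/
def pd {s : ℕ} (a : Idx s) (f : Field s) : Field s :=
  fun u => fderiv ℝ f u (Pi.single a 1)

/-- On `U`, the function `f` is a function of the coordinates with index in `S` only. -/
def DependsOnlyOn {s : ℕ} (U : Set (Pt s)) (S : Set (Idx s)) (f : Field s) : Prop :=
  ∀ u ∈ U, ∀ v ∈ U, (∀ a ∈ S, u a = v a) → f u = f v

/-- The coordinates `(u^(τ), ζ^(2k+2))`, `τ` in the shells before shell `k`, on which the
coefficients of shell `k` may depend; for `k = 1` these are `(x¹, x², y⁴)`. -/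
def shellVars {s : ℕ} (k : Fin (s + 2)) : Set (Idx s) :=
  {a | a.1 < k ∨ a = (k, 1)}

/-- The free functions of the ansatz and of the sources.
For `k ≥ 1`: `h k 0 = h_(2k+1)`, `h k 1 = h_(2k+2)`, `n k τ = N_τ^(2k+1)` and
`w k τ = N_τ^(2k+2)`, where `τ` runs over the shells before `k` (the values at `k = 0`, and at
the other indices `τ`, are never used).  `Λ 0 = Λ(x)`, `Λ 1 = ᵛΛ`, `Λ 2 = ₁ᵛΛ`, and so on. -/
structure Ansatz (s : ℕ) where
  ε : Fin 2 → ℝ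
  ψ : Field s
  h : Fin (s + 2) → Fin 2 → Field s
  n : Fin (s + 2) → Idx s → Field s
  w : Fin (s + 2) → Idx s → Field s
  Λ : Fin (s + 2) → Field s

namespace Ansatz

variable {s : ℕ}

/-- The standing assumptions on the ansatz and on the sources over the domain `U`. -/
structure IsAdmissibleOn (A : Ansatz s) (U : Set (Pt s)) : Prop where
  sign : ∀ i, A.ε i = 1 ∨ A.ε i = -1
  smooth_ψ : ContDiffOn ℝ ∞ A.ψ U
  dep_ψ : DependsOnlyOn U {a | a.1 = 0} A.ψ
  smooth_h : ∀ k, k ≠ 0 → ∀ c, ContDiffOn ℝ ∞ (A.h k c) U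
  dep_h : ∀ k, k ≠ 0 → ∀ c, DependsOnlyOn U (shellVars k) (A.h k c)
  h_ne_zero : ∀ k, k ≠ 0 → ∀ c, ∀ u ∈ U, A.h k c u ≠ 0
  pd_h_ne_zero : ∀ k, k ≠ 0 → ∀ u ∈ U, pd (k, 1) (A.h k 0) u ≠ 0
  smooth_n : ∀ k τ, τ.1 < k → ContDiffOn ℝ ∞ (A.n k τ) U
  dep_n : ∀ k τ, τ.1 < k → DependsOnlyOn U (shellVars k) (A.n k τ)
  smooth_w : ∀ k τ, τ.1 < k → ContDiffOn ℝ ∞ (A.w k τ) U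
  dep_w : ∀ k τ, τ.1 < k → DependsOnlyOn U (shellVars k) (A.w k τ)
  dep_Λ_zero : DependsOnlyOn U {a | a.1 = 0} (A.Λ 0)
  dep_Λ : ∀ k, k ≠ 0 → DependsOnlyOn U (shellVars k) (A.Λ k)

/-! ### The d-metric and the N-adapted frames -/

/-- The coefficient `g_a` of the d-metric `∑ g_a 𝐞^a ⊗ 𝐞^a`:
`g_i = ε_i e^ψ` on the first shell and `h_a` on the other ones. -/
def g (A : Ansatz s) (a : Idx s) : Field s :=
  if a.1 = 0 then fun u => A.ε a.2 * Real.exp (A.ψ u) else A.h a.1 a.2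

/-- The d-metric in the N-adapted frame, a diagonal matrix of functions. -/
def gm (A : Ansatz s) (a b : Idx s) : Field s :=
  if a = b then A.g a else 0

/-- The N-connection coefficient `N_τ^a`, nonzero only if the shell of `τ` is before that
of `a`. -/
def N (A : Ansatz s) (τ a : Idx s) : Field s :=
  if τ.1 < a.1 then (if a.2 = 0 then A.n a.1 τ else A.w a.1 τ) else 0

/-- The matrix of the N-adapted coframe `𝐞^a = du^a + ∑_τ N_τ^a du^τ`; the entry `(a, b)` is
the coefficient of `du^b` in `𝐞^a`. -/
def coframe (A : Ansatz s) (u : Pt s) : Matrix (Idx s) (Idx s) ℝ :=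
  Matrix.of fun a b => (if a = b then 1 else 0) + A.N b a u

/-- The matrix of the dual N-adapted frame; the entry `(c, b)` is the coefficient of
`∂/∂u^c` in `𝐞_b`.  The coframe matrix is unipotent, so this is a true inverse. -/
def frame (A : Ansatz s) (u : Pt s) : Matrix (Idx s) (Idx s) ℝ :=
  (A.coframe u)⁻¹

/-- The action of the frame vector field `𝐞_b` on functions. -/
def e (A : Ansatz s) (b : Idx s) (f : Field s) : Field s :=
  fun u => ∑ c, A.frame u c b * pd c f u

/-- The nonholonomy coefficients: `[𝐞_a, 𝐞_b] = ∑_c W a b c 𝐞_c`. -/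
def W (A : Ansatz s) (a b c : Idx s) : Field s :=
  fun u => ∑ d, A.coframe u c d *
    (A.e a (fun v => A.frame v d b) u - A.e b (fun v => A.frame v d a) u)

/-! ### The canonical d-connection and its curvature -/

/-- The coefficients `Γ^c_{b a}` of the canonical d-connection, `D_(𝐞_a) 𝐞_b = ∑_c Γ^c_{b a} 𝐞_c`.
The connection preserves the shell splitting, so that `c` and `b` have to be in the same shell.
* If `a` is in that shell too, the coefficient is
  `(1/2) g^{cc} (𝐞_a g_{bc} + 𝐞_b g_{ac} - 𝐞_c g_{ba})`.
* If `a` is in another shell, it is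
  `W_{ab}^c + (1/2) g^{cc} (𝐞_a g_{bc} - W_{ab}^c g_{cc} - W_{ac}^b g_{bb})`.
  For `a` in a lower shell `W_{ab}^c` is the derivative of the N-connection coefficient in the
  direction `b`, and this is the coefficient
  `L^c_{ba} = 𝐞_b N_a^c + (1/2) g^{cd} (𝐞_a g_{bd} - g_{fd} 𝐞_b N_a^f - g_{fb} 𝐞_d N_a^f)`;
  for `a` in a higher shell `W_{ab}^c = 0`, and it is `C^c_{ba} = (1/2) g^{cd} 𝐞_a g_{bd}`. -/
def Γ (A : Ansatz s) (c b a : Idx s) : Field s := fun u =>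
  if c.1 = b.1 then
    (if a.1 = b.1 then
      (A.e a (A.gm b c) u + A.e b (A.gm a c) u - A.e c (A.gm b a) u) / (2 * A.g c u)
    else
      A.W a b c u
        + (A.e a (A.gm b c) u - A.W a b c u * A.g c u - A.W a c b u * A.g b u)
            / (2 * A.g c u))
  else 0

/-- The curvature `R^d_{c b a}`, the component along `𝐞_d` of `R(𝐞_a, 𝐞_b) 𝐞_c`, where
`R(X, Y) = D_X D_Y - D_Y D_X - D_[X, Y]`. -/
def riem (A : Ansatz s) (d c b a : Idx s) : Field s := fun u =>
  A.e a (A.Γ d c b) u - A.e b (A.Γ d c a) u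
    + ∑ f, (A.Γ f c b u * A.Γ d f a u - A.Γ f c a u * A.Γ d f b u
        - A.W a b f u * A.Γ d c f u)

/-- The Ricci d-tensor `R_{a b} = ∑_d R^d_{a b d}`; it is not symmetric in general. -/
def ricci (A : Ansatz s) (a b : Idx s) : Field s :=
  fun u => ∑ d, A.riem d a b d u

/-- The scalar curvature `∑ g^{ab} R_{ab}` of the canonical d-connection. -/
def scalar (A : Ansatz s) : Field s :=
  fun u => ∑ a, A.ricci a a u / A.g a u

/-- The mixed source `Υ^a_a` for `a` in shell `k`: the sum of all `Λ j` with `j ≠ k`. -/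
def source (A : Ansatz s) (k : Fin (s + 2)) : Field s :=
  fun u => ∑ j ∈ Finset.univ.erase k, A.Λ j u

/-- The modified Einstein equations `R_{ab} - (1/2) g_{ab} R = Υ_{ab}` at the point `u`, for all
N-adapted indices, where `Υ^a_b = diag (source)` and `Υ_{ab} = g_{ac} Υ^c_b`. -/
def EinsteinEquationsAt (A : Ansatz s) (u : Pt s) : Prop :=
  ∀ a b, A.ricci a b u - 1 / 2 * A.gm a b u * A.scalar u = A.gm a b u * A.source b.1 u

/-! ### Generating functions -/

/-- `φ = ln |∂_(2k+2) h_(2k+1) / √|h_(2k+1) h_(2k+2)||`. -/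
def φ (A : Ansatz s) (k : Fin (s + 2)) : Field s := fun u =>
  Real.log |pd (k, 1) (A.h k 0) u / Real.sqrt (|A.h k 0 u * A.h k 1 u|)|

/-- `γ = ∂_(2k+2) ln (|h_(2k+1)|^(3/2) / |h_(2k+2)|^(1/2))`. -/
def γ (A : Ansatz s) (k : Fin (s + 2)) : Field s :=
  pd (k, 1) fun u => Real.log (|A.h k 0 u| ^ (3 / 2 : ℝ) / Real.sqrt |A.h k 1 u|)

/-- `α_τ = (∂_τ φ) (∂_(2k+2) h_(2k+1)) / (2 h_(2k+1))`. -/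
def α (A : Ansatz s) (k : Fin (s + 2)) (τ : Idx s) : Field s := fun u =>
  pd τ (A.φ k) u * pd (k, 1) (A.h k 0) u / (2 * A.h k 0 u)

/-- `β = (∂_(2k+2) φ) (∂_(2k+2) h_(2k+1)) / (2 h_(2k+1))`. -/
def β (A : Ansatz s) (k : Fin (s + 2)) : Field s := fun u =>
  pd (k, 1) (A.φ k) u * pd (k, 1) (A.h k 0) u / (2 * A.h k 0 u)

end Ansatz

end JetDecoupling

end

/-! The whole structure is triangular in the shell index. The N-adapted frame is a unipotent block
triangular change of basis, the coefficients of shell `k` depend only on coordinates of shells up to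
`k`, and the canonical d-connection preserves every shell. Hence each Ricci coefficient with first
index in shell `k` is a finite sum over that shell (`ricci_eq`), and the shell of the second index
leaves three cases.

Second index in a later shell: the coefficient vanishes (`ricci_of_lt`). Same shell: the Ricci block
is `K_k` times the metric, as for a surface (`ricci_of_eq`). Second index `τ` in an earlier shell:
up to nonvanishing factors, the two coefficients are `∑_d frame_dτ (n_d'' + γ n_d')` and `∑_d
frame_dτ (∂_d φ - w_d φ')`, where the prime is the derivative in the direction `2k+2`
(`ricci_zero_below`, `ricci_one_below`). The block of the frame formed by the earlier shells is
invertible, so these vanish for all `τ` exactly when each bracket does.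

The scalar curvature is `2 ∑ K_j`, so the diagonal Einstein equation in shell `k` says `∑_{j ≠ k}
(K_j + Λ_j) = 0`. The matrix of this linear system has zeros on the diagonal and ones elsewhere; it
is invertible, which gives `K_j = -Λ_j` on each shell separately. Written out, these are the
equation for `ψ` and the equations for `φ` and `h`. -/

namespace JetDecoupling

/-! ### Calculus of functions of a subset of the coordinates -/

variable {s : ℕ} {U : Set (Pt s)} {S T : Set (Idx s)} {f g : Field s} {u : Pt s}

/-- `f` is smooth on `U` and depends there only on the coordinates with index in `S`. -/
structure SmoothOf (U : Set (Pt s)) (S : Set (Idx s)) (f : Field s) : Prop where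
  smooth : ContDiffOn ℝ ∞ f U
  dep : DependsOnlyOn U S f

theorem fderiv_congr_of_eqOn (hU : IsOpen U) (hu : u ∈ U) (h : Set.EqOn f g U) :
    fderiv ℝ f u = fderiv ℝ g u :=
  (h.eventuallyEq_of_mem (hU.mem_nhds hu)).fderiv_eq

theorem pd_congr (hU : IsOpen U) (hu : u ∈ U) (h : Set.EqOn f g U) (a : Idx s) :
    pd a f u = pd a g u := by
  rw [pd, pd, fderiv_congr_of_eqOn hU hu h]

theorem pd_const (a : Idx s) (c : ℝ) : pd a (fun _ => c) u = 0 := by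
  simp [pd]

theorem DependsOnlyOn.mono (h : DependsOnlyOn U S f) (hST : S ⊆ T) : DependsOnlyOn U T f :=
  fun u hu v hv huv => h u hu v hv fun a ha => huv a (hST ha)

/-- Translating both points by the same small vector preserves their agreement on `S`, so the two
translates of `f` coincide near `0`. Openness of `U` is enough; no connectedness enters. -/
theorem DependsOnlyOn.fderiv_eq (h : DependsOnlyOn U S f) (hU : IsOpen U) {v : Pt s}
    (hu : u ∈ U) (hv : v ∈ U) (huv : ∀ a ∈ S, u a = v a) :
    fderiv ℝ f u = fderiv ℝ f v := by
  have key : (fun x => f (u + x)) =ᶠ[nhds 0] fun x => f (v + x) := by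
    have h1 : ∀ w ∈ U, ∀ᶠ x in nhds (0 : Pt s), w + x ∈ U := fun w hw => by
      have : ContinuousAt (fun x : Pt s => w + x) 0 := by fun_prop
      exact this.eventually (by simpa using hU.mem_nhds hw)
    filter_upwards [h1 u hu, h1 v hv] with x hx hx'
    exact h _ hx _ hx' fun a ha => by simp [huv a ha]
  have := key.fderiv_eq (𝕜 := ℝ)
  simpa [fderiv_comp_add_left] using this

theorem DependsOnlyOn.pd_eq_zero (h : DependsOnlyOn U S f) (hU : IsOpen U) (hu : u ∈ U)
    (hf : DifferentiableAt ℝ f u) {a : Idx s} (ha : a ∉ S) : pd a f u = 0 := by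
  have h1 : HasDerivAt (fun t : ℝ => f (u + t • Pi.single a 1)) (pd a f u) 0 := by
    have := (hf.hasFDerivAt.hasLineDerivAt (Pi.single a (1 : ℝ)))
    exact this
  have h2 : (fun t : ℝ => f (u + t • Pi.single a 1)) =ᶠ[nhds 0] fun _ => f u := by
    have hc : ContinuousAt (fun t : ℝ => u + t • (Pi.single a 1 : Pt s)) 0 := by fun_prop
    have hm : ∀ᶠ t : ℝ in nhds 0, u + t • (Pi.single a 1 : Pt s) ∈ U :=
      hc.eventually_mem (by simpa using hU.mem_nhds hu)
    filter_upwards [hm] with t ht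
    refine h _ ht _ hu fun b hb => ?_
    have : b ≠ a := fun e => ha (e ▸ hb)
    simp [this]
  exact h1.unique ((hasDerivAt_const _ _).congr_of_eventuallyEq h2)

namespace SmoothOf

theorem mono (h : SmoothOf U S f) (hST : S ⊆ T) : SmoothOf U T f :=
  ⟨h.smooth, h.dep.mono hST⟩

theorem differentiableAt (h : SmoothOf U S f) (hU : IsOpen U) (hu : u ∈ U) :
    DifferentiableAt ℝ f u :=
  (h.smooth.contDiffAt (hU.mem_nhds hu)).differentiableAt (by simp)

theorem congr (h : SmoothOf U S f) (hfg : Set.EqOn g f U) : SmoothOf U S g :=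
  ⟨h.smooth.congr hfg, fun u hu v hv huv => by rw [hfg hu, hfg hv, h.dep u hu v hv huv]⟩

theorem const (c : ℝ) : SmoothOf U S (fun _ => c) :=
  ⟨contDiffOn_const, fun _ _ _ _ _ => rfl⟩

theorem add (hf : SmoothOf U S f) (hg : SmoothOf U S g) : SmoothOf U S (fun u => f u + g u) :=
  ⟨hf.smooth.add hg.smooth,
    fun u hu v hv huv => by rw [hf.dep u hu v hv huv, hg.dep u hu v hv huv]⟩

theorem sub (hf : SmoothOf U S f) (hg : SmoothOf U S g) : SmoothOf U S (fun u => f u - g u) :=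
  ⟨hf.smooth.sub hg.smooth,
    fun u hu v hv huv => by rw [hf.dep u hu v hv huv, hg.dep u hu v hv huv]⟩

theorem mul (hf : SmoothOf U S f) (hg : SmoothOf U S g) : SmoothOf U S (fun u => f u * g u) :=
  ⟨hf.smooth.mul hg.smooth,
    fun u hu v hv huv => by rw [hf.dep u hu v hv huv, hg.dep u hu v hv huv]⟩

theorem div (hf : SmoothOf U S f) (hg : SmoothOf U S g) (h0 : ∀ u ∈ U, g u ≠ 0) :
    SmoothOf U S (fun u => f u / g u) :=
  ⟨hf.smooth.div hg.smooth h0,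
    fun u hu v hv huv => by rw [hf.dep u hu v hv huv, hg.dep u hu v hv huv]⟩

theorem exp (hf : SmoothOf U S f) : SmoothOf U S (fun u => Real.exp (f u)) :=
  ⟨hf.smooth.exp, fun u hu v hv huv => by rw [hf.dep u hu v hv huv]⟩

theorem log (hf : SmoothOf U S f) (h0 : ∀ u ∈ U, f u ≠ 0) :
    SmoothOf U S (fun u => Real.log (f u)) :=
  ⟨hf.smooth.log h0, fun u hu v hv huv => by rw [hf.dep u hu v hv huv]⟩

theorem sum {ι : Type*} (I : Finset ι) {F : ι → Field s} (h : ∀ i ∈ I, SmoothOf U S (F i)) :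
    SmoothOf U S (fun u => ∑ i ∈ I, F i u) :=
  ⟨ContDiffOn.sum fun i hi => (h i hi).smooth,
    fun u hu v hv huv => Finset.sum_congr rfl fun i hi => (h i hi).dep u hu v hv huv⟩

/-- The class is closed under differentiation, so the variables of every curvature term can be
tracked without computing it. -/
theorem pd (hf : SmoothOf U S f) (hU : IsOpen U) (a : Idx s) : SmoothOf U S (pd a f) :=
  ⟨(hf.smooth.fderiv_of_isOpen hU (m := ∞) (by simp)).clm_apply contDiffOn_const,
    fun u hu v hv huv => by
      simp only [JetDecoupling.pd, hf.dep.fderiv_eq hU hu hv huv]⟩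

theorem pd_eq_zero (hf : SmoothOf U S f) (hU : IsOpen U) (hu : u ∈ U) {a : Idx s}
    (ha : a ∉ S) : JetDecoupling.pd a f u = 0 :=
  hf.dep.pd_eq_zero hU hu (hf.differentiableAt hU hu) ha

theorem pd_comm (hf : SmoothOf U S f) (hU : IsOpen U) (hu : u ∈ U) (a b : Idx s) :
    JetDecoupling.pd a (JetDecoupling.pd b f) u = JetDecoupling.pd b (JetDecoupling.pd a f) u := by
  have hc := hf.smooth.contDiffAt (hU.mem_nhds hu)
  have hsymm : IsSymmSndFDerivAt ℝ f u := hc.isSymmSndFDerivAt (by simpa using (by norm_cast : (2 : WithTop ℕ∞) ≤ ∞))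
  have hd : DifferentiableAt ℝ (fderiv ℝ f) u :=
    (hc.fderiv_right (m := 1) (by norm_cast)).differentiableAt (by simp)
  have key : ∀ x y : Pt s,
      fderiv ℝ (fun v => fderiv ℝ f v y) u x = fderiv ℝ (fderiv ℝ f) u x y := by
    intro x y
    have := (hd.hasFDerivAt.clm_apply (hasFDerivAt_const y u)).fderiv
    rw [this]; simp
  change fderiv ℝ (fun v => fderiv ℝ f v _) u _ = fderiv ℝ (fun v => fderiv ℝ f v _) u _
  rw [key, key]
  exact hsymm _ _

end SmoothOf

section Rules

variable {v : Pt s}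

theorem fderiv_mul_apply (hf : DifferentiableAt ℝ f u) (hg : DifferentiableAt ℝ g u) :
    fderiv ℝ (fun x => f x * g x) u v = fderiv ℝ f u v * g u + f u * fderiv ℝ g u v := by
  rw [fderiv_fun_mul hf hg]
  simp; ring

theorem fderiv_div_apply (hf : DifferentiableAt ℝ f u) (hg : DifferentiableAt ℝ g u)
    (h0 : g u ≠ 0) :
    fderiv ℝ (fun x => f x / g x) u v
      = (fderiv ℝ f u v * g u - f u * fderiv ℝ g u v) / g u ^ 2 := by
  have h : HasFDerivAt (fun x => f x * (g x)⁻¹) _ u :=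
    hf.hasFDerivAt.fun_mul ((hasDerivAt_inv h0).comp_hasFDerivAt u hg.hasFDerivAt)
  simp only [div_eq_mul_inv]
  rw [h.fderiv]
  simp
  field_simp
  ring

end Rules

namespace Ansatz

variable {s : ℕ} {A : Ansatz s} {U : Set (Pt s)} {S : Set (Idx s)} {f g : Field s} {u : Pt s}

/-! ### The N-adapted frames -/

theorem N_of_le {τ a : Idx s} (h : a.1 ≤ τ.1) : A.N τ a = 0 := by
  simp [N, not_lt.2 h]

theorem N_zero_right {k : Fin (s + 2)} {τ : Idx s} (h : τ.1 < k) : A.N τ (k, 0) = A.n k τ := by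
  simp [N, h]

theorem N_one_right {k : Fin (s + 2)} {τ : Idx s} (h : τ.1 < k) : A.N τ (k, 1) = A.w k τ := by
  simp [N, h]

theorem isUnit_det_coframe (A : Ansatz s) (u : Pt s) : IsUnit (A.coframe u).det := by
  -- `BlockTriangular` means upper triangular, while `N` fills the blocks below the diagonal; hence
  -- the transpose.
  have hb : (A.coframe u).transpose.BlockTriangular (Prod.fst : Idx s → Fin (s + 2)) := by
    intro a b hab
    have hne : b ≠ a := by rintro rfl; exact lt_irrefl _ hab
    simp [coframe, hne, N_of_le hab.le]
  rw [← Matrix.det_transpose, hb.det_fintype]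
  suffices ∀ k, (A.coframe u).transpose.toSquareBlock (Prod.fst : Idx s → Fin (s + 2)) k = 1 by
    simp [this]
  intro k
  ext ⟨a, ha⟩ ⟨b, hb⟩
  have hN : A.N a b = 0 := N_of_le (by rw [ha, hb])
  simp [Matrix.toSquareBlock_def, coframe, Matrix.one_apply, hN, eq_comm]

theorem coframe_mul_frame (A : Ansatz s) (u : Pt s) : A.coframe u * A.frame u = 1 :=
  Matrix.mul_nonsing_inv _ (A.isUnit_det_coframe u)

theorem frame_mul_coframe (A : Ansatz s) (u : Pt s) : A.frame u * A.coframe u = 1 :=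
  Matrix.nonsing_inv_mul _ (A.isUnit_det_coframe u)

theorem sum_coframe_mul (A : Ansatz s) (u : Pt s) (c : Idx s) (x : Idx s → ℝ) :
    ∑ d, A.coframe u c d * x d = x c + ∑ d with d.1 < c.1, A.N d c u * x d := by
  simp only [coframe, Matrix.of_apply, add_mul, Finset.sum_add_distrib, Finset.sum_filter]
  congr 1
  · simp
  · refine Finset.sum_congr rfl fun d _ => ?_
    split_ifs with h
    · rfl
    · simp [N_of_le (not_lt.1 h)]

/-- Row `c` of `coframe * frame = 1`, that is, forward substitution. Induction on the shell with
this recursion replaces any explicit inverse. -/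
theorem frame_eq (A : Ansatz s) (u : Pt s) (c b : Idx s) :
    A.frame u c b = (if c = b then 1 else 0) - ∑ d with d.1 < c.1, A.N d c u * A.frame u d b := by
  have h := congrFun (congrFun (A.coframe_mul_frame u) c) b
  rw [Matrix.mul_apply, A.sum_coframe_mul u c fun d => A.frame u d b, Matrix.one_apply] at h
  linarith

theorem frame_of_lt (A : Ansatz s) (u : Pt s) {c b : Idx s} (h : c.1 < b.1) :
    A.frame u c b = 0 := by
  obtain ⟨k, hk⟩ : ∃ k, k = c.1 := ⟨_, rfl⟩
  induction k using WellFoundedLT.induction generalizing c with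
  | ind k ih =>
    have hne : c ≠ b := by rintro rfl; exact lt_irrefl _ h
    rw [frame_eq, if_neg hne, Finset.sum_eq_zero, sub_zero]
    intro d hd
    simp only [Finset.mem_filter, Finset.mem_univ, true_and] at hd
    rw [ih d.1 (hk ▸ hd) (hd.trans h) rfl, mul_zero]

theorem frame_of_eq (A : Ansatz s) (u : Pt s) {c b : Idx s} (h : c.1 = b.1) :
    A.frame u c b = if c = b then 1 else 0 := by
  rw [frame_eq, Finset.sum_eq_zero, sub_zero]
  intro d hd
  simp only [Finset.mem_filter, Finset.mem_univ, true_and] at hd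
  rw [A.frame_of_lt u (h ▸ hd), mul_zero]

/-- The frame coefficients of the shells before shell `k` form an invertible matrix. -/
theorem forall_sum_frame_eq_zero_iff (A : Ansatz s) (u : Pt s) (k : Fin (s + 2))
    (x : Idx s → ℝ) :
    (∀ b : Idx s, b.1 < k → ∑ d with d.1 < k, A.frame u d b * x d = 0) ↔
      ∀ d : Idx s, d.1 < k → x d = 0 := by
  constructor
  · intro h
    -- Extension by zero turns the partial sums into a product with the whole frame: its later
    -- columns vanish on the rows of earlier shells. The coframe then inverts it.
    set y : Idx s → ℝ := fun d => if d.1 < k then x d else 0 with hy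
    have hs : ∀ b, ∑ d, y d * A.frame u d b = ∑ d with d.1 < k, A.frame u d b * x d := by
      intro b
      rw [Finset.sum_filter]
      refine Finset.sum_congr rfl fun d _ => ?_
      simp only [hy]
      split_ifs <;> ring
    have h0 : Matrix.vecMul y (A.frame u) = 0 := by
      funext b
      change ∑ d, y d * A.frame u d b = 0
      rw [hs]
      by_cases hb : b.1 < k
      · exact h b hb
      · refine Finset.sum_eq_zero fun d hd => ?_
        simp only [Finset.mem_filter, Finset.mem_univ, true_and] at hd
        rw [A.frame_of_lt u (hd.trans_le (not_lt.1 hb)), zero_mul]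
    have h1 : y = 0 := by
      have := congrArg (fun z => Matrix.vecMul z (A.coframe u)) h0
      simpa [Matrix.vecMul_vecMul, A.frame_mul_coframe] using this
    intro d hd
    have := congrFun h1 d
    simpa [hy, hd] using this
  · intro h b _
    refine Finset.sum_eq_zero fun d hd => ?_
    simp only [Finset.mem_filter, Finset.mem_univ, true_and] at hd
    rw [h d hd, mul_zero]

/-! ### Smoothness and dependence of the coefficients -/

/-- The coordinates on which the coefficients of shell `k` depend. -/
def coefVars (k : Fin (s + 2)) : Set (Idx s) :=
  if k = 0 then {a | a.1 = 0} else shellVars k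

theorem coefVars_of_ne {k : Fin (s + 2)} (hk : k ≠ 0) :
    (coefVars k : Set (Idx s)) = shellVars k := if_neg hk

theorem shellVars_subset (k : Fin (s + 2)) : (shellVars k : Set (Idx s)) ⊆ {a | a.1 ≤ k} := by
  rintro a (h | rfl)
  · exact (h : a.1 < k).le
  · exact le_refl k

theorem coefVars_subset (k : Fin (s + 2)) : (coefVars k : Set (Idx s)) ⊆ {a | a.1 ≤ k} := by
  rw [coefVars]
  split_ifs with h
  · intro a ha
    exact (ha : a.1 = 0).trans_le (Fin.zero_le _)
  · exact shellVars_subset k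

/-- The Killing symmetry: nothing in shell `k` depends on `u^(2k+1)`. -/
theorem zero_notMem_shellVars (k : Fin (s + 2)) : ((k, 0) : Idx s) ∉ shellVars k := by
  simp [shellVars]

theorem le_subset_shellVars {j k : Fin (s + 2)} (h : j < k) :
    ({a | a.1 ≤ j} : Set (Idx s)) ⊆ shellVars k :=
  fun a ha => Or.inl (lt_of_le_of_lt (show a.1 ≤ j from ha) h)

variable (hU : IsOpen U) (hA : A.IsAdmissibleOn U) (hu : u ∈ U)
include hA

theorem smoothOf_N {τ c : Idx s} (h : τ.1 < c.1) : SmoothOf U (shellVars c.1) (A.N τ c) := by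
  rw [N, if_pos h]
  split_ifs
  · exact ⟨hA.smooth_n _ _ h, hA.dep_n _ _ h⟩
  · exact ⟨hA.smooth_w _ _ h, hA.dep_w _ _ h⟩

theorem smoothOf_h {k : Fin (s + 2)} (hk : k ≠ 0) (c : Fin 2) :
    SmoothOf U (shellVars k) (A.h k c) :=
  ⟨hA.smooth_h k hk c, hA.dep_h k hk c⟩

theorem smoothOf_ψ : SmoothOf U {a | a.1 = 0} A.ψ := ⟨hA.smooth_ψ, hA.dep_ψ⟩

theorem smoothOf_g (a : Idx s) : SmoothOf U (coefVars a.1) (A.g a) := by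
  rw [g, coefVars]
  split_ifs with h
  · exact (SmoothOf.const _).mul (smoothOf_ψ hA).exp
  · exact smoothOf_h hA h _

theorem ε_ne_zero (i : Fin 2) : A.ε i ≠ 0 := by
  rcases hA.sign i with h | h <;> rw [h] <;> norm_num

theorem ε_sq (i : Fin 2) : A.ε i * A.ε i = 1 := by
  rcases hA.sign i with h | h <;> rw [h] <;> norm_num

include hu in
theorem g_ne_zero (a : Idx s) : A.g a u ≠ 0 := by
  rw [g]
  split_ifs with h
  · exact mul_ne_zero (ε_ne_zero hA _) (Real.exp_ne_zero _)
  · exact hA.h_ne_zero _ h _ _ hu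

theorem smoothOf_frame (c b : Idx s) :
    SmoothOf U {a | a.1 ≤ c.1} (fun u => A.frame u c b) := by
  obtain ⟨k, hk⟩ : ∃ k, k = c.1 := ⟨_, rfl⟩
  induction k using WellFoundedLT.induction generalizing c with
  | ind k ih =>
    have : (fun u => A.frame u c b) = fun u =>
        (if c = b then 1 else 0) - ∑ d with d.1 < c.1, A.N d c u * A.frame u d b := by
      funext u; exact A.frame_eq u c b
    rw [this]
    refine (SmoothOf.const _).sub (SmoothOf.sum _ fun d hd => ?_)
    simp only [Finset.mem_filter, Finset.mem_univ, true_and] at hd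
    refine ((smoothOf_N hA hd).mono (shellVars_subset _)).mul
      ((ih d.1 (hk ▸ hd) d rfl).mono fun a ha => ?_)
    exact le_trans ha hd.le

omit hA

/-! ### The frame vector fields on functions -/

/-- As a Fréchet derivative along a vector, `e` inherits linearity and the product and quotient
rules. -/
theorem e_eq_fderiv (A : Ansatz s) (b : Idx s) (f : Field s) (u : Pt s) :
    A.e b f u = fderiv ℝ f u (fun c => A.frame u c b) := by
  rw [e]
  conv_rhs => rw [pi_eq_sum_univ' (fun c => A.frame u c b), map_sum]
  refine Finset.sum_congr rfl fun c _ => ?_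
  rw [map_smul, smul_eq_mul, pd]

include hU hu in
theorem e_congr (h : Set.EqOn f g U) (b : Idx s) : A.e b f u = A.e b g u := by
  rw [e_eq_fderiv, e_eq_fderiv, fderiv_congr_of_eqOn hU hu h]

theorem e_const (b : Idx s) (c : ℝ) : A.e b (fun _ => c) u = 0 := by
  simp [e_eq_fderiv]

theorem e_zero (b : Idx s) : A.e b 0 u = 0 := e_const b 0

include hU hu

/-- A frame vector field kills the functions of the coordinates of the earlier shells. -/
theorem e_of_gt {k : Fin (s + 2)} (hf : SmoothOf U {a | a.1 ≤ k} f) {b : Idx s} (hb : k < b.1) :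
    A.e b f u = 0 := by
  refine Finset.sum_eq_zero fun c _ => ?_
  by_cases hc : c.1 ≤ k
  · rw [A.frame_of_lt u (lt_of_le_of_lt hc hb), zero_mul]
  · rw [hf.pd_eq_zero hU hu (by simpa using hc), mul_zero]

/-- Column `b` of the frame is zero in earlier shells and a unit vector in its own, and `f` does not
see the later ones. -/
theorem e_of_eq {b : Idx s} (hf : SmoothOf U {a | a.1 ≤ b.1} f) :
    A.e b f u = pd b f u := by
  rw [e, Finset.sum_eq_single b]
  · rw [A.frame_of_eq u rfl, if_pos rfl, one_mul]
  · intro c _ hcb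
    rcases lt_trichotomy c.1 b.1 with hc | hc | hc
    · rw [A.frame_of_lt u hc, zero_mul]
    · rw [A.frame_of_eq u hc, if_neg hcb, zero_mul]
    · rw [hf.pd_eq_zero hU hu (by simpa using hc), mul_zero]
  · simp

/-- By the recursion, the `∂_(2k+2)` component of `𝐞_b` is `-∑ w_d frame_db`. The `n_d` drop out
because `f` ignores `u^(2k+1)`. -/
theorem e_of_lt {k : Fin (s + 2)} (hf : SmoothOf U (shellVars k) f) {b : Idx s} (hb : b.1 < k) :
    A.e b f u
      = ∑ d with d.1 < k, A.frame u d b * (pd d f u - A.w k d u * pd (k, 1) f u) := by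
  have h1 : A.frame u (k, 1) b = -∑ d with d.1 < k, A.w k d u * A.frame u d b := by
    have hne : ((k, 1) : Idx s) ≠ b := by rintro rfl; exact lt_irrefl _ hb
    rw [frame_eq, if_neg hne, zero_sub]
    congr 1
    refine Finset.sum_congr rfl fun d hd => ?_
    simp only [Finset.mem_filter, Finset.mem_univ, true_and] at hd
    rw [N_one_right hd]
  have h2 : A.e b f u = A.frame u (k, 1) b * pd (k, 1) f u
      + ∑ d with d.1 < k, A.frame u d b * pd d f u := by
    rw [e, ← Finset.sum_filter_add_sum_filter_not _ (fun d : Idx s => d.1 < k), add_comm]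
    congr 1
    rw [Finset.sum_eq_single ((k, 1) : Idx s)]
    · intro d hd hne
      simp only [Finset.mem_filter, Finset.mem_univ, true_and] at hd
      rw [hf.pd_eq_zero hU hu (by rintro (h | h) <;> tauto), mul_zero]
    · simp
  rw [h2, h1, neg_mul, Finset.sum_mul, neg_add_eq_sub, ← Finset.sum_sub_distrib]
  exact Finset.sum_congr rfl fun d _ => by ring

omit hu
include hA

theorem smoothOf_e_of_lt {k : Fin (s + 2)} (hf : SmoothOf U (shellVars k) f) {b : Idx s}
    (hb : b.1 < k) : SmoothOf U (shellVars k) (A.e b f) := by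
  refine SmoothOf.congr (SmoothOf.sum (Finset.univ.filter fun d : Idx s => d.1 < k)
    (F := fun d u => A.frame u d b * (pd d f u - A.w k d u * pd (k, 1) f u)) fun d hd => ?_)
    fun u hu => e_of_lt hU hu hf hb
  simp only [Finset.mem_filter, Finset.mem_univ, true_and] at hd
  exact ((smoothOf_frame hA d b).mono (le_subset_shellVars hd)).mul
    ((hf.pd hU d).sub (SmoothOf.mul ⟨hA.smooth_w _ _ hd, hA.dep_w _ _ hd⟩ (hf.pd hU _)))

include hu

/-! ### The nonholonomy coefficients -/

/-- Differentiating `coframe * frame = 1` gives `coframe * 𝐞_a(frame) = -𝐞_a(coframe) * frame`,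
which trades derivatives of the inverse matrix for derivatives of `N`. -/
theorem W_eq (a b c : Idx s) :
    A.W a b c u = ∑ d with d.1 < c.1,
      (A.e b (A.N d c) u * A.frame u d a - A.e a (A.N d c) u * A.frame u d b) := by
  have key : ∀ a b, ∑ d, A.coframe u c d * A.e a (fun v => A.frame v d b) u
      = -∑ d with d.1 < c.1, A.e a (A.N d c) u * A.frame u d b := by
    intro a b
    have hF : ∀ d, DifferentiableAt ℝ (fun v => A.frame v d b) u := fun d =>
      (smoothOf_frame hA d b).differentiableAt hU hu
    have hN : ∀ d : Idx s, d.1 < c.1 → DifferentiableAt ℝ (A.N d c) u := fun d hd =>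
      (smoothOf_N hA hd).differentiableAt hU hu
    have h0 : A.e a (fun v => A.frame v c b) u
        = -∑ d with d.1 < c.1, (A.e a (A.N d c) u * A.frame u d b
            + A.N d c u * A.e a (fun v => A.frame v d b) u) := by
      have h : (fun v => A.frame v c b) = fun v =>
          (if c = b then 1 else 0) - ∑ d with d.1 < c.1, A.N d c v * A.frame v d b := by
        funext v; exact A.frame_eq v c b
      rw [h, e_eq_fderiv, fderiv_const_sub, fderiv_fun_sum]
      · rw [neg_apply, sum_apply]
        congr 1
        refine Finset.sum_congr rfl fun d hd => ?_
        simp only [Finset.mem_filter, Finset.mem_univ, true_and] at hd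
        rw [fderiv_mul_apply (hN d hd) (hF d), e_eq_fderiv, e_eq_fderiv]
      · intro d hd
        simp only [Finset.mem_filter, Finset.mem_univ, true_and] at hd
        exact (hN d hd).mul (hF d)
    rw [sum_coframe_mul, h0, Finset.sum_add_distrib]
    ring
  rw [W]
  simp only [mul_sub, Finset.sum_sub_distrib]
  rw [key, key]
  ring

theorem W_swap (a b c : Idx s) : A.W a b c u = -A.W b a c u := by
  rw [W_eq hU hA hu, W_eq hU hA hu, ← Finset.sum_neg_distrib]
  exact Finset.sum_congr rfl fun d _ => by ring

theorem W_of_gt {a b c : Idx s} (h : c.1 < a.1) : A.W a b c u = 0 := by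
  rw [W_eq hU hA hu]
  refine Finset.sum_eq_zero fun d hd => ?_
  simp only [Finset.mem_filter, Finset.mem_univ, true_and] at hd
  rw [A.frame_of_lt u (hd.trans h),
    e_of_gt hU hu ((smoothOf_N hA hd).mono (shellVars_subset _)) h]
  ring

theorem W_of_gt' {a b c : Idx s} (h : c.1 < b.1) : A.W a b c u = 0 := by
  rw [W_swap hU hA hu, W_of_gt hU hA hu h, neg_zero]

theorem W_shell (k : Fin (s + 2)) (i j l : Fin 2) : A.W (k, i) (k, j) (k, l) u = 0 := by
  rw [W_eq hU hA hu]
  refine Finset.sum_eq_zero fun d hd => ?_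
  simp only [Finset.mem_filter, Finset.mem_univ, true_and] at hd
  rw [A.frame_of_lt u (b := (k, i)) hd, A.frame_of_lt u (b := (k, j)) hd]
  ring

/-- The frame vectors of shell `k` have no components in earlier shells, so one of the two terms of
`W_eq` disappears. -/
theorem W_shell_right (a : Idx s) (k : Fin (s + 2)) (i j : Fin 2) :
    A.W a (k, i) (k, j) u = ∑ d with d.1 < k, A.frame u d a * pd (k, i) (A.N d (k, j)) u := by
  rw [W_eq hU hA hu]
  refine Finset.sum_congr rfl fun d hd => ?_
  simp only [Finset.mem_filter, Finset.mem_univ, true_and] at hd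
  rw [A.frame_of_lt u (b := (k, i)) hd,
    e_of_eq hU hu (b := (k, i)) ((smoothOf_N (c := (k, j)) hA hd).mono (shellVars_subset _))]
  ring

end Ansatz

/-! ### Rules for coordinate derivatives -/

section Rules

variable {s : ℕ} {U : Set (Pt s)} {S : Set (Idx s)} {f g : Field s} {u : Pt s} (a : Idx s)

theorem pd_add (hf : DifferentiableAt ℝ f u) (hg : DifferentiableAt ℝ g u) :
    pd a (fun x => f x + g x) u = pd a f u + pd a g u := by
  rw [pd, fderiv_fun_add hf hg]; rfl

theorem pd_sub (hf : DifferentiableAt ℝ f u) (hg : DifferentiableAt ℝ g u) :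
    pd a (fun x => f x - g x) u = pd a f u - pd a g u := by
  rw [pd, fderiv_fun_sub hf hg]; rfl

theorem pd_neg : pd a (fun x => -f x) u = -pd a f u := by
  rw [pd, fderiv_fun_neg]; rfl

theorem pd_sum {ι : Type*} (I : Finset ι) {F : ι → Field s}
    (h : ∀ i ∈ I, DifferentiableAt ℝ (F i) u) :
    pd a (fun x => ∑ i ∈ I, F i x) u = ∑ i ∈ I, pd a (F i) u := by
  rw [pd, fderiv_fun_sum h, sum_apply]; rfl

theorem pd_mul (hf : DifferentiableAt ℝ f u) (hg : DifferentiableAt ℝ g u) :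
    pd a (fun x => f x * g x) u = pd a f u * g u + f u * pd a g u :=
  fderiv_mul_apply hf hg

theorem pd_const_mul (c : ℝ) (hf : DifferentiableAt ℝ f u) :
    pd a (fun x => c * f x) u = c * pd a f u := by
  rw [pd, fderiv_const_mul hf]; rfl

theorem pd_div (hf : DifferentiableAt ℝ f u) (hg : DifferentiableAt ℝ g u) (h0 : g u ≠ 0) :
    pd a (fun x => f x / g x) u = (pd a f u * g u - f u * pd a g u) / g u ^ 2 :=
  fderiv_div_apply hf hg h0

theorem pd_div_const (c : ℝ) (hf : DifferentiableAt ℝ f u) :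
    pd a (fun x => f x / c) u = pd a f u / c := by
  simp only [div_eq_inv_mul]
  rw [pd_const_mul a _ hf]

theorem pd_exp (hf : DifferentiableAt ℝ f u) :
    pd a (fun x => Real.exp (f x)) u = Real.exp (f u) * pd a f u := by
  rw [pd, fderiv_exp hf]; rfl

theorem pd_log (hf : DifferentiableAt ℝ f u) (h0 : f u ≠ 0) :
    pd a (fun x => Real.log (f x)) u = pd a f u / f u := by
  rw [pd, fderiv.log hf h0]
  simp [pd, div_eq_inv_mul]

end Rules

namespace Ansatz

variable {s : ℕ} {A : Ansatz s} {U : Set (Pt s)} {f : Field s} {u : Pt s}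

/-! ### The coefficients of the canonical d-connection -/

theorem Γ_of_ne {c b : Idx s} (h : c.1 ≠ b.1) (a : Idx s) : A.Γ c b a = 0 := by
  funext u; simp [Γ, h]

theorem e_gm (A : Ansatz s) (x a b : Idx s) (u : Pt s) :
    A.e x (A.gm a b) u = if a = b then A.e x (A.g a) u else 0 := by
  unfold gm
  split_ifs
  · rfl
  · exact e_zero x

theorem shell_pd_eq_zero {k : Fin (s + 2)} (hU : IsOpen U) (hu : u ∈ U)
    (hf : SmoothOf U (shellVars k) f) : pd (k, 0) f u = 0 :=
  hf.pd_eq_zero hU hu (zero_notMem_shellVars k)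

variable (hU : IsOpen U) (hA : A.IsAdmissibleOn U)
include hU hA

theorem e_g_of_eq {x b : Idx s} (hu : u ∈ U) (h : x.1 = b.1) :
    A.e x (A.g b) u = pd x (A.g b) u :=
  e_of_eq hU hu ((smoothOf_g hA b).mono (h ▸ coefVars_subset _))

theorem Γ_shell (hu : u ∈ U) (k : Fin (s + 2)) (i j l : Fin 2) :
    A.Γ (k, i) (k, j) (k, l) u = ((if j = i then pd (k, l) (A.g (k, i)) u else 0)
      + (if l = i then pd (k, j) (A.g (k, i)) u else 0)
      - (if j = l then pd (k, i) (A.g (k, j)) u else 0)) / (2 * A.g (k, i) u) := by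
  have he : ∀ x y : Fin 2, A.e (k, x) (A.g (k, y)) u = pd (k, x) (A.g (k, y)) u := fun x y =>
    e_g_of_eq hU hA hu rfl
  rw [Γ, if_pos rfl, if_pos rfl, e_gm, e_gm, e_gm, he, he, he]
  simp only [Prod.mk.injEq, true_and]
  congr 3 <;>
  · split_ifs with h
    · rw [h]
    · rfl

theorem smoothOf_Γ_shell (k : Fin (s + 2)) (i j l : Fin 2) :
    SmoothOf U (coefVars k) (A.Γ (k, i) (k, j) (k, l)) := by
  have hg : ∀ x, SmoothOf U (coefVars k) (A.g (k, x)) := fun x => smoothOf_g hA (k, x)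
  refine SmoothOf.congr ?_ fun u hu => Γ_shell hU hA hu k i j l
  refine SmoothOf.div (SmoothOf.sub (SmoothOf.add ?_ ?_) ?_)
    ((SmoothOf.const 2).mul (hg i))
    fun u hu => mul_ne_zero two_ne_zero (g_ne_zero hA hu (k, i))
  all_goals split_ifs
  all_goals first
    | exact SmoothOf.const 0
    | exact (hg _).pd hU _

/-- A later frame vector kills the metric coefficients of shell `k`, and its brackets have no
component there. -/
theorem Γ_of_gt {k : Fin (s + 2)} {a : Idx s} (hu : u ∈ U) (i j : Fin 2) (ha : k < a.1) :
    A.Γ (k, i) (k, j) a u = 0 := by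
  rw [Γ, if_pos rfl, if_neg ha.ne', W_of_gt hU hA hu (c := (k, i)) ha,
    W_of_gt hU hA hu (c := (k, j)) ha, e_gm,
    e_of_gt hU hu ((smoothOf_g hA (k, j)).mono (coefVars_subset _)) ha]
  simp

theorem smoothOf_W (τ : Idx s) (k : Fin (s + 2)) (i j : Fin 2) :
    SmoothOf U (shellVars k) (A.W τ (k, i) (k, j)) := by
  refine SmoothOf.congr (SmoothOf.sum (Finset.univ.filter fun d : Idx s => d.1 < k)
    (F := fun d u => A.frame u d τ * pd (k, i) (A.N d (k, j)) u) fun d hd => ?_)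
    fun u hu => W_shell_right hU hA hu τ k i j
  simp only [Finset.mem_filter, Finset.mem_univ, true_and] at hd
  exact ((smoothOf_frame hA d τ).mono (le_subset_shellVars hd)).mul
    ((smoothOf_N (c := (k, j)) hA hd).pd hU _)

theorem smoothOf_Γ_of_lt {k : Fin (s + 2)} {τ : Idx s} (hτ : τ.1 < k) (i j : Fin 2) :
    SmoothOf U (shellVars k) (A.Γ (k, i) (k, j) τ) := by
  have hg : ∀ x, SmoothOf U (shellVars k) (A.g (k, x)) := fun x => by
    have := smoothOf_g hA (k, x)
    rwa [coefVars_of_ne (lt_of_le_of_lt (Fin.zero_le _) hτ).ne'] at this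
  have : A.Γ (k, i) (k, j) τ = fun u => A.W τ (k, j) (k, i) u
        + (A.e τ (A.gm (k, j) (k, i)) u - A.W τ (k, j) (k, i) u * A.g (k, i) u
            - A.W τ (k, i) (k, j) u * A.g (k, j) u) / (2 * A.g (k, i) u) := by
    funext u; rw [Γ, if_pos rfl, if_neg hτ.ne]
  rw [this]
  have h1 := smoothOf_W hU hA τ k j i
  have h2 := smoothOf_W hU hA τ k i j
  have h3 : SmoothOf U (shellVars k) (A.gm (k, j) (k, i)) := by
    unfold gm
    split_ifs
    · exact hg j
    · exact SmoothOf.const 0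
  exact h1.add (SmoothOf.div (((smoothOf_e_of_lt hU hA h3 hτ).sub (h1.mul (hg i))).sub
    (h2.mul (hg j))) ((SmoothOf.const 2).mul (hg i))
    fun u hu => mul_ne_zero two_ne_zero (g_ne_zero hA hu (k, i)))

/-! ### The Ricci tensor as a sum over a shell -/

/-- Only the indices of the shell of `a` contribute to the Ricci coefficients `R_{ab}`. -/
theorem ricci_eq (hu : u ∈ U) (k : Fin (s + 2)) (i : Fin 2) (b : Idx s) :
    A.ricci (k, i) b u = ∑ d : Fin 2,
      (A.e (k, d) (A.Γ (k, d) (k, i) b) u - A.e b (A.Γ (k, d) (k, i) (k, d)) u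
        + ∑ f : Fin 2, (A.Γ (k, f) (k, i) b u * A.Γ (k, d) (k, f) (k, d) u
          - A.Γ (k, f) (k, i) (k, d) u * A.Γ (k, d) (k, f) b u
          - A.W (k, d) b (k, f) u * A.Γ (k, d) (k, i) (k, f) u)) := by
  have shell_sum : ∀ F : Idx s → ℝ, (∀ d : Idx s, d.1 ≠ k → F d = 0) →
      ∑ d, F d = ∑ d : Fin 2, F (k, d) := by
    intro F hF
    rw [Fintype.sum_prod_type, Finset.sum_eq_single k]
    · intro l _ hl
      exact Finset.sum_eq_zero fun d _ => hF _ hl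
    · simp
  rw [ricci, shell_sum]
  · refine Finset.sum_congr rfl fun d _ => ?_
    rw [riem, shell_sum]
    intro f hf
    rw [Γ_of_ne (c := f) hf, Γ_of_ne (c := f) hf]
    -- Only the bracket term is left: for `f` in an earlier shell `W` vanishes, for `f` in a later
    -- one `Γ` does.
    rcases lt_or_gt_of_ne hf with h | h
    · rw [W_of_gt hU hA hu (a := (k, d)) h]
      simp
    · rw [Γ_of_gt hU hA hu d i h]
      simp
  · intro d hd
    rw [riem, Γ_of_ne (c := d) hd, Γ_of_ne (c := d) hd, e_zero, e_zero, sub_zero, zero_add]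
    refine Finset.sum_eq_zero fun f _ => ?_
    rw [Γ_of_ne (c := d) (b := (k, i)) hd]
    by_cases hf : f.1 = k
    · rw [Γ_of_ne (c := d) (b := f) (hf ▸ hd), Γ_of_ne (c := d) (b := f) (hf ▸ hd)]
      simp
    · rw [Γ_of_ne (c := f) hf, Γ_of_ne (c := f) hf]
      simp

/-- Each term contains a connection coefficient along `b`, a derivative along `𝐞_b` of a function of
the shells up to that of `a`, or a bracket component in a shell before `b`. -/
theorem ricci_of_lt (hu : u ∈ U) {a b : Idx s} (h : a.1 < b.1) : A.ricci a b u = 0 := by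
  obtain ⟨k, i⟩ := a
  rw [ricci_eq hU hA hu]
  refine Finset.sum_eq_zero fun d _ => ?_
  have hΓ : ∀ x y : Fin 2, Set.EqOn (A.Γ (k, x) (k, y) b) 0 U := fun x y v hv =>
    Γ_of_gt hU hA hv x y h
  rw [e_congr hU hu (hΓ d i), e_zero,
    e_of_gt hU hu ((smoothOf_Γ_shell hU hA k d i d).mono (coefVars_subset _)) h,
    sub_zero, zero_add]
  refine Finset.sum_eq_zero fun f _ => ?_
  rw [hΓ f i hu, hΓ d f hu, W_of_gt' hU hA hu (b := b) (c := (k, f)) h]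
  simp

end Ansatz

namespace Ansatz

variable {s : ℕ} {A : Ansatz s} {U : Set (Pt s)} {f : Field s} {u : Pt s}

theorem g_of_ne {k : Fin (s + 2)} (hk : k ≠ 0) (i : Fin 2) : A.g (k, i) = A.h k i := by
  simp [g, hk]

variable (hU : IsOpen U) (hA : A.IsAdmissibleOn U)
include hU hA

/-! ### Derivatives of the generating functions -/

section Shell

variable {k : Fin (s + 2)} (hk : k ≠ 0)
include hk

-- `Real.log` is even, so the absolute values disappear and `φ` is a combination of logarithms of
-- smooth nonvanishing functions.
omit hU in
theorem φ_eqOn : Set.EqOn (A.φ k) (fun u => Real.log (pd (k, 1) (A.h k 0) u)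
    - (Real.log (A.h k 0 u) / 2 + Real.log (A.h k 1 u) / 2)) U := by
  intro u hu
  have h0 := hA.h_ne_zero k hk 0 u hu
  have h1 := hA.h_ne_zero k hk 1 u hu
  have hp : 0 < |A.h k 0 u * A.h k 1 u| := abs_pos.2 (mul_ne_zero h0 h1)
  change Real.log _ = _
  rw [Real.log_abs, Real.log_div (hA.pd_h_ne_zero k hk u hu) (Real.sqrt_pos.2 hp).ne',
    Real.log_sqrt hp.le, Real.log_abs, Real.log_mul h0 h1]
  ring

theorem smoothOf_φ : SmoothOf U (shellVars k) (A.φ k) := by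
  have hl := fun i => (smoothOf_h hA hk i).log (hA.h_ne_zero k hk i)
  refine SmoothOf.congr ?_ (φ_eqOn hA hk)
  refine (((smoothOf_h hA hk 0).pd hU _).log (hA.pd_h_ne_zero k hk)).sub (SmoothOf.add ?_ ?_)
  · exact (hl 0).div (SmoothOf.const 2) fun _ _ => two_ne_zero
  · exact (hl 1).div (SmoothOf.const 2) fun _ _ => two_ne_zero

variable (hu : u ∈ U)
include hu

theorem pd_φ (a : Idx s) :
    pd a (A.φ k) u = pd a (pd (k, 1) (A.h k 0)) u / pd (k, 1) (A.h k 0) u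
      - (pd a (A.h k 0) u / A.h k 0 u / 2 + pd a (A.h k 1) u / A.h k 1 u / 2) := by
  have hd := fun i => (smoothOf_h hA hk i).differentiableAt hU hu
  have hl := fun i => (hd i).log (hA.h_ne_zero k hk i u hu)
  have hl2 : ∀ i, DifferentiableAt ℝ (fun v => Real.log (A.h k i v) / 2) u := fun i => by
    simpa only [div_eq_mul_inv] using (hl i).mul_const _
  have hd' := ((smoothOf_h hA hk 0).pd hU (k, 1)).differentiableAt hU hu
  have hl' := hd'.log (hA.pd_h_ne_zero k hk u hu)
  rw [pd_congr hU hu (φ_eqOn hA hk),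
    pd_sub a hl' ((hl2 0).fun_add (hl2 1)), pd_add a (hl2 0) (hl2 1), pd_div_const a 2 (hl 0),
    pd_div_const a 2 (hl 1), pd_log a (hd 0) (hA.h_ne_zero k hk 0 u hu),
    pd_log a (hd 1) (hA.h_ne_zero k hk 1 u hu), pd_log a hd' (hA.pd_h_ne_zero k hk u hu)]

theorem γ_eq :
    A.γ k u = 3 / 2 * (pd (k, 1) (A.h k 0) u / A.h k 0 u)
      - pd (k, 1) (A.h k 1) u / A.h k 1 u / 2 := by
  have hd := fun i => (smoothOf_h hA hk i).differentiableAt hU hu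
  have hl := fun i => (hd i).log (hA.h_ne_zero k hk i u hu)
  have hl2 : ∀ i, DifferentiableAt ℝ (fun v => Real.log (A.h k i v) / 2) u := fun i => by
    simpa only [div_eq_mul_inv] using (hl i).mul_const _
  have heq : Set.EqOn (fun u => Real.log (|A.h k 0 u| ^ (3 / 2 : ℝ) / Real.sqrt |A.h k 1 u|))
      (fun u => 3 / 2 * Real.log (A.h k 0 u) - Real.log (A.h k 1 u) / 2) U := by
    intro v hv
    have h0 := abs_pos.2 (hA.h_ne_zero k hk 0 v hv)
    have h1 := abs_pos.2 (hA.h_ne_zero k hk 1 v hv)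
    change Real.log _ = _
    rw [Real.log_div (Real.rpow_pos_of_pos h0 _).ne' (Real.sqrt_pos.2 h1).ne',
      Real.log_rpow h0, Real.log_sqrt h1.le, Real.log_abs, Real.log_abs]
  rw [γ, pd_congr hU hu heq, pd_sub _ ((hl 0).const_mul (3 / 2)) (hl2 1),
    pd_const_mul _ _ (hl 0), pd_div_const _ 2 (hl 1),
    pd_log _ (hd 0) (hA.h_ne_zero k hk 0 u hu), pd_log _ (hd 1) (hA.h_ne_zero k hk 1 u hu)]

omit hu

/-! ### The connection inside a shell -/

/-- By the Killing symmetry only `∂_(2k+2)` acts nontrivially on the metric of the shell; four of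
the eight coefficients survive. -/
theorem Γ_000 : Set.EqOn (A.Γ (k, 0) (k, 0) (k, 0)) (fun _ => 0) U := fun u hu => by
  rw [Γ_shell hU hA hu, g_of_ne hk]
  simp [shell_pd_eq_zero hU hu (smoothOf_h hA hk 0)]

theorem Γ_001 : Set.EqOn (A.Γ (k, 0) (k, 0) (k, 1))
    (fun u => pd (k, 1) (A.h k 0) u / (2 * A.h k 0 u)) U := fun u hu => by
  rw [Γ_shell hU hA hu, g_of_ne hk]
  simp

theorem Γ_010 : Set.EqOn (A.Γ (k, 0) (k, 1) (k, 0))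
    (fun u => pd (k, 1) (A.h k 0) u / (2 * A.h k 0 u)) U := fun u hu => by
  rw [Γ_shell hU hA hu, g_of_ne hk]
  simp

theorem Γ_011 : Set.EqOn (A.Γ (k, 0) (k, 1) (k, 1)) (fun _ => 0) U := fun u hu => by
  rw [Γ_shell hU hA hu, g_of_ne hk, g_of_ne hk]
  simp [shell_pd_eq_zero hU hu (smoothOf_h hA hk 1)]

theorem Γ_100 : Set.EqOn (A.Γ (k, 1) (k, 0) (k, 0))
    (fun u => -(pd (k, 1) (A.h k 0) u / (2 * A.h k 1 u))) U := fun u hu => by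
  rw [Γ_shell hU hA hu, g_of_ne hk, g_of_ne hk]
  simp [neg_div]

theorem Γ_101 : Set.EqOn (A.Γ (k, 1) (k, 0) (k, 1)) (fun _ => 0) U := fun u hu => by
  rw [Γ_shell hU hA hu, g_of_ne hk]
  simp [shell_pd_eq_zero hU hu (smoothOf_h hA hk 1)]

theorem Γ_110 : Set.EqOn (A.Γ (k, 1) (k, 1) (k, 0)) (fun _ => 0) U := fun u hu => by
  rw [Γ_shell hU hA hu, g_of_ne hk]
  simp [shell_pd_eq_zero hU hu (smoothOf_h hA hk 1)]

theorem Γ_111 : Set.EqOn (A.Γ (k, 1) (k, 1) (k, 1))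
    (fun u => pd (k, 1) (A.h k 1) u / (2 * A.h k 1 u)) U := fun u hu => by
  rw [Γ_shell hU hA hu, g_of_ne hk]
  simp

omit hU hA hk in
/-- Derivative of `p / (2 q)`. -/
theorem pd_div_two_mul {p q : Field s} (a : Idx s) (hp : DifferentiableAt ℝ p u)
    (hq : DifferentiableAt ℝ q u) (h0 : q u ≠ 0) :
    pd a (fun u => p u / (2 * q u)) u
      = (pd a p u * q u - p u * pd a q u) / (2 * q u ^ 2) := by
  rw [pd_div a hp (hq.const_mul 2) (mul_ne_zero two_ne_zero h0), pd_const_mul a 2 hq]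
  field_simp

include hu

omit hA hk in
theorem e_shell {S : Set (Idx s)} (hS : S ⊆ shellVars k) (hf : SmoothOf U S f) (i : Fin 2) :
    A.e (k, i) f u = if i = 0 then 0 else pd (k, 1) f u := by
  rw [e_of_eq hU hu (b := (k, i)) (hf.mono (hS.trans (shellVars_subset k)))]
  fin_cases i
  · exact shell_pd_eq_zero hU hu (hf.mono hS)
  · rfl

/-- The Ricci coefficients inside a shell. -/
theorem ricci_shell (i j : Fin 2) :
    A.ricci (k, i) (k, j) u = if i = j then
      -(pd (k, 1) (A.φ k) u * pd (k, 1) (A.h k 0) u / (2 * A.h k 0 u * A.h k 1 u)) * A.h k i u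
      else 0 := by
  have he : ∀ a b c d, A.e (k, d) (A.Γ (k, c) (k, b) (k, a)) u
      = if d = 0 then 0 else pd (k, 1) (A.Γ (k, c) (k, b) (k, a)) u := fun a b c d =>
    e_shell hU hu (coefVars_of_ne hk).le (smoothOf_Γ_shell hU hA k _ _ _) d
  have hW : ∀ a b c, A.W (k, a) (k, b) (k, c) u = 0 := fun a b c => W_shell hU hA hu k a b c
  have d0 := (smoothOf_h hA hk 0).differentiableAt hU hu
  have d1 := (smoothOf_h hA hk 1).differentiableAt hU hu
  have d0' := ((smoothOf_h hA hk 0).pd hU (k, 1)).differentiableAt hU hu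
  have d1' := ((smoothOf_h hA hk 1).pd hU (k, 1)).differentiableAt hU hu
  have h0 := hA.h_ne_zero k hk 0 u hu
  have h1 := hA.h_ne_zero k hk 1 u hu
  have h2 := hA.pd_h_ne_zero k hk u hu
  rw [ricci_eq hU hA hu]
  simp only [he, hW, Fin.sum_univ_two]
  fin_cases i <;> fin_cases j <;>
  simp only [Fin.zero_eta, Fin.mk_one, Fin.isValue, if_true, one_ne_zero, zero_ne_one, if_false,
    pd_congr hU hu (Γ_000 hU hA hk), pd_congr hU hu (Γ_001 hU hA hk),
    pd_congr hU hu (Γ_010 hU hA hk), pd_congr hU hu (Γ_011 hU hA hk),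
    pd_congr hU hu (Γ_100 hU hA hk), pd_congr hU hu (Γ_101 hU hA hk),
    pd_congr hU hu (Γ_110 hU hA hk), pd_congr hU hu (Γ_111 hU hA hk),
    Γ_000 hU hA hk hu, Γ_001 hU hA hk hu, Γ_010 hU hA hk hu, Γ_011 hU hA hk hu,
    Γ_100 hU hA hk hu, Γ_101 hU hA hk hu, Γ_110 hU hA hk hu, Γ_111 hU hA hk hu,
    pd_const, pd_neg, pd_div_two_mul (k, 1) d0' d0 h0,
    pd_div_two_mul (k, 1) d0' d1 h1,
    pd_div_two_mul (k, 1) d1' d1 h1, pd_φ hU hA hk hu]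
  all_goals
    field_simp
    ring

/-! ### The Ricci coefficients with second index in an earlier shell -/

section Below

variable {τ : Idx s} (hτ : τ.1 < k)
include hτ

omit hU hA hu in
theorem Γ_below (i j : Fin 2) (u : Pt s) : A.Γ (k, i) (k, j) τ u =
    A.W τ (k, j) (k, i) u + ((if j = i then A.e τ (A.h k i) u else 0)
      - A.W τ (k, j) (k, i) u * A.h k i u - A.W τ (k, i) (k, j) u * A.h k j u)
        / (2 * A.h k i u) := by
  rw [Γ, if_pos rfl, if_neg hτ.ne, e_gm, g_of_ne hk, g_of_ne hk]
  simp only [Prod.mk.injEq, true_and]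
  congr 4
  split_ifs with h
  · rw [h]
  · rfl

omit hu hk

-- These brackets are sums of `∂_(2k+1)` derivatives of `N`, which vanish by the Killing symmetry.
omit hτ in
theorem W_below_zero (i : Fin 2) : Set.EqOn (A.W τ (k, 0) (k, i)) (fun _ => 0) U := by
  intro u hu
  rw [W_shell_right hU hA hu]
  refine Finset.sum_eq_zero fun d hd => ?_
  simp only [Finset.mem_filter, Finset.mem_univ, true_and] at hd
  rw [shell_pd_eq_zero hU hu (smoothOf_N (c := (k, i)) hA hd), mul_zero]

include hk

theorem Γ_00_below : Set.EqOn (A.Γ (k, 0) (k, 0) τ)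
    (fun u => A.e τ (A.h k 0) u / (2 * A.h k 0 u)) U := fun u hu => by
  rw [Γ_below hk hτ, W_below_zero hU hA (τ := τ) 0 hu]
  simp

theorem Γ_01_below : Set.EqOn (A.Γ (k, 0) (k, 1) τ) (fun u => A.W τ (k, 1) (k, 0) u / 2) U :=
  fun u hu => by
  have h0 := hA.h_ne_zero k hk 0 u hu
  rw [Γ_below hk hτ, W_below_zero hU hA (τ := τ) 1 hu]
  simp
  field_simp
  ring

theorem Γ_10_below : Set.EqOn (A.Γ (k, 1) (k, 0) τ)
    (fun u => -(A.W τ (k, 1) (k, 0) u * A.h k 0 u / (2 * A.h k 1 u))) U := fun u hu => by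
  rw [Γ_below hk hτ, W_below_zero hU hA (τ := τ) 1 hu]
  simp [neg_div]

-- The bracket terms cancel, so `w` enters this coefficient only through `𝐞_τ`.
omit hU in
theorem Γ_11_below : Set.EqOn (A.Γ (k, 1) (k, 1) τ)
    (fun u => A.e τ (A.h k 1) u / (2 * A.h k 1 u)) U := fun u hu => by
  have h0 := hA.h_ne_zero k hk 1 u hu
  rw [Γ_below hk hτ]
  simp
  field_simp
  ring

include hu

-- The frame rows of earlier shells do not involve `u^(2k+2)`.
omit hk hτ in
theorem pd_sum_frame (F : Idx s → Field s) (hF : ∀ d, d.1 < k → SmoothOf U (shellVars k) (F d)) :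
    pd (k, 1) (fun u => ∑ d with d.1 < k, A.frame u d τ * F d u) u
      = ∑ d with d.1 < k, A.frame u d τ * pd (k, 1) (F d) u := by
  rw [pd_sum]
  · refine Finset.sum_congr rfl fun d hd => ?_
    simp only [Finset.mem_filter, Finset.mem_univ, true_and] at hd
    rw [pd_mul _ ((smoothOf_frame hA d τ).differentiableAt hU hu)
      ((hF d hd).differentiableAt hU hu),
      (smoothOf_frame hA d τ).pd_eq_zero hU hu (by simpa using hd), zero_mul, zero_add]
  · intro d hd
    simp only [Finset.mem_filter, Finset.mem_univ, true_and] at hd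
    exact ((smoothOf_frame hA d τ).differentiableAt hU hu).mul
      ((hF d hd).differentiableAt hU hu)

omit hk in
/-- The commutator of `∂_(2k+2)` and `𝐞_τ` on the functions of the coordinates of shell `k`. -/
theorem pd_e_sub_e_pd (hf : SmoothOf U (shellVars k) f) :
    pd (k, 1) (A.e τ f) u - A.e τ (pd (k, 1) f) u
      = -A.W τ (k, 1) (k, 1) u * pd (k, 1) f u := by
  have hw : ∀ d : Idx s, d.1 < k → SmoothOf U (shellVars k) (A.w k d) := fun d hd =>
    ⟨hA.smooth_w _ _ hd, hA.dep_w _ _ hd⟩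
  rw [pd_congr hU hu (fun v hv => e_of_lt hU hv hf hτ), e_of_lt hU hu (hf.pd hU _) hτ,
    pd_sum_frame hU hA hu (fun d u => pd d f u - A.w k d u * pd (k, 1) f u) fun d hd =>
      (hf.pd hU d).sub ((hw d hd).mul (hf.pd hU _)),
    W_shell_right hU hA hu, ← Finset.sum_sub_distrib, neg_mul, Finset.sum_mul,
    ← Finset.sum_neg_distrib]
  refine Finset.sum_congr rfl fun d hd => ?_
  simp only [Finset.mem_filter, Finset.mem_univ, true_and] at hd
  have hfd : ∀ a, DifferentiableAt ℝ (pd a f) u := fun a => (hf.pd hU a).differentiableAt hU hu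
  have hwd := (hw d hd).differentiableAt hU hu
  rw [pd_sub _ (hfd d) (hwd.fun_mul (hfd _)), pd_mul _ hwd (hfd _), hf.pd_comm hU hu (k, 1) d,
    N_one_right (k := k) hd]
  ring

/-- Put `X = W τ (k,1) (k,0) = ∑ frame_dτ n_d'`. The derivative of `Γ_10 = -X h_(2k+1) / (2
h_(2k+2))` supplies `X'`, and the quadratic terms complete the coefficient of `X` to `γ`. -/
theorem ricci_zero_below : A.ricci (k, 0) τ u = -(A.h k 0 u / (2 * A.h k 1 u)) *
    ∑ d with d.1 < k, A.frame u d τ *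
      (pd (k, 1) (pd (k, 1) (A.n k d)) u + A.γ k u * pd (k, 1) (A.n k d) u) := by
  have hn : ∀ d : Idx s, d.1 < k → SmoothOf U (shellVars k) (A.n k d) := fun d hd =>
    ⟨hA.smooth_n _ _ hd, hA.dep_n _ _ hd⟩
  have hW : ∀ v ∈ U, A.W τ (k, 1) (k, 0) v
      = ∑ d with d.1 < k, A.frame v d τ * pd (k, 1) (A.n k d) v := by
    intro v hv
    rw [W_shell_right hU hA hv]
    refine Finset.sum_congr rfl fun d hd => ?_
    simp only [Finset.mem_filter, Finset.mem_univ, true_and] at hd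
    rw [N_zero_right (k := k) hd]
  have hsum : (∑ d with d.1 < k, A.frame u d τ *
      (pd (k, 1) (pd (k, 1) (A.n k d)) u + A.γ k u * pd (k, 1) (A.n k d) u))
      = pd (k, 1) (A.W τ (k, 1) (k, 0)) u + A.γ k u * A.W τ (k, 1) (k, 0) u := by
    rw [pd_congr hU hu hW, hW u hu, pd_sum_frame hU hA hu _ fun d hd => (hn d hd).pd hU _,
      Finset.mul_sum, ← Finset.sum_add_distrib]
    exact Finset.sum_congr rfl fun d _ => by ring
  have he : ∀ c b d, A.e (k, d) (A.Γ (k, c) (k, b) τ) u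
      = if d = 0 then 0 else pd (k, 1) (A.Γ (k, c) (k, b) τ) u := fun c b d =>
    e_shell hU hu subset_rfl (smoothOf_Γ_of_lt hU hA hτ _ _) d
  have hWs : ∀ i j, A.W (k, i) τ (k, j) u = -A.W τ (k, i) (k, j) u := fun i j =>
    W_swap hU hA hu _ _ _
  have d0 := (smoothOf_h hA hk 0).differentiableAt hU hu
  have d1 := (smoothOf_h hA hk 1).differentiableAt hU hu
  have dW : DifferentiableAt ℝ (A.W τ (k, 1) (k, 0)) u :=
    (smoothOf_W hU hA τ k 1 0).differentiableAt hU hu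
  have h0 := hA.h_ne_zero k hk 0 u hu
  have h1 := hA.h_ne_zero k hk 1 u hu
  rw [hsum, ricci_eq hU hA hu, γ_eq hU hA hk hu]
  simp only [Fin.sum_univ_two, he, hWs, Fin.isValue, if_true, one_ne_zero, if_false,
    e_congr hU hu (Γ_000 hU hA hk), e_congr hU hu (Γ_101 hU hA hk), e_const,
    pd_congr hU hu (Γ_10_below hU hA hk hτ), W_below_zero hU hA (τ := τ) 0 hu,
    W_below_zero hU hA (τ := τ) 1 hu, Γ_00_below hU hA hk hτ hu, Γ_01_below hU hA hk hτ hu,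
    Γ_10_below hU hA hk hτ hu, Γ_11_below hA hk hτ hu,
    Γ_000 hU hA hk hu, Γ_001 hU hA hk hu, Γ_010 hU hA hk hu,
    Γ_100 hU hA hk hu, Γ_101 hU hA hk hu, Γ_111 hU hA hk hu,
    pd_neg, pd_div_two_mul (k, 1) (dW.fun_mul d0) d1 h1, pd_mul (k, 1) dW d0]
  field_simp
  ring

/-- The contribution of `d = 1` cancels, the commutator of `∂_(2k+2)` and `𝐞_τ` against the bracket
term; that of `d = 0` collects into `𝐞_τ φ`. -/
theorem ricci_one_below : A.ricci (k, 1) τ u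
    = -(pd (k, 1) (A.h k 0) u / (2 * A.h k 0 u)) *
      ∑ d with d.1 < k, A.frame u d τ * (pd d (A.φ k) u - A.w k d u * pd (k, 1) (A.φ k) u) := by
  have hh := fun i => smoothOf_h hA hk i
  have he : ∀ c b d, A.e (k, d) (A.Γ (k, c) (k, b) τ) u
      = if d = 0 then 0 else pd (k, 1) (A.Γ (k, c) (k, b) τ) u := fun c b d =>
    e_shell hU hu subset_rfl (smoothOf_Γ_of_lt hU hA hτ _ _) d
  have hWs : ∀ i j, A.W (k, i) τ (k, j) u = -A.W τ (k, i) (k, j) u := fun i j =>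
    W_swap hU hA hu _ _ _
  have d0 := (hh 0).differentiableAt hU hu
  have d1 := (hh 1).differentiableAt hU hu
  have d0' := ((hh 0).pd hU (k, 1)).differentiableAt hU hu
  have d1' := ((hh 1).pd hU (k, 1)).differentiableAt hU hu
  have de := (smoothOf_e_of_lt hU hA (hh 1) hτ).differentiableAt hU hu
  have h0 := hA.h_ne_zero k hk 0 u hu
  have h1 := hA.h_ne_zero k hk 1 u hu
  have h2 := hA.pd_h_ne_zero k hk u hu
  have e_div : ∀ p q : Field s, DifferentiableAt ℝ p u → DifferentiableAt ℝ q u → q u ≠ 0 →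
      A.e τ (fun u => p u / (2 * q u)) u
        = (A.e τ p u * q u - p u * A.e τ q u) / (2 * q u ^ 2) := by
    intro p q hp hq hq0
    simp only [e_eq_fderiv]
    rw [fderiv_div_apply hp (hq.const_mul 2) (mul_ne_zero two_ne_zero hq0),
      fderiv_const_mul hq]
    simp only [smul_apply, smul_eq_mul]
    field_simp
  have hφ : A.e τ (A.φ k) u = A.e τ (pd (k, 1) (A.h k 0)) u / pd (k, 1) (A.h k 0) u
      - (A.e τ (A.h k 0) u / A.h k 0 u / 2 + A.e τ (A.h k 1) u / A.h k 1 u / 2) := by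
    simp only [e, pd_φ hU hA hk hu, Finset.sum_div, ← Finset.sum_add_distrib,
      ← Finset.sum_sub_distrib]
    exact Finset.sum_congr rfl fun d _ => by ring
  have hcomm : pd (k, 1) (A.e τ (A.h k 1)) u = A.e τ (pd (k, 1) (A.h k 1)) u
      - A.W τ (k, 1) (k, 1) u * pd (k, 1) (A.h k 1) u := by
    linear_combination pd_e_sub_e_pd hU hA hu hτ (hh 1)
  rw [← e_of_lt hU hu (smoothOf_φ hU hA hk) hτ, hφ, ricci_eq hU hA hu]
  simp only [Fin.sum_univ_two, he, hWs, Fin.isValue, if_true, one_ne_zero, if_false,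
    e_congr hU hu (Γ_010 hU hA hk), e_congr hU hu (Γ_111 hU hA hk),
    e_div _ _ d0' d0 h0, e_div _ _ d1' d1 h1,
    pd_congr hU hu (Γ_11_below hA hk hτ), W_below_zero hU hA (τ := τ) 0 hu,
    W_below_zero hU hA (τ := τ) 1 hu, Γ_00_below hU hA hk hτ hu, Γ_01_below hU hA hk hτ hu,
    Γ_10_below hU hA hk hτ hu, Γ_11_below hA hk hτ hu,
    Γ_000 hU hA hk hu, Γ_010 hU hA hk hu, Γ_011 hU hA hk hu,
    Γ_101 hU hA hk hu, Γ_110 hU hA hk hu, Γ_111 hU hA hk hu,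
    pd_div_two_mul (k, 1) de d1 h1, hcomm]
  field_simp
  ring

end Below

end Shell

end Ansatz

/-! ### Shell curvatures and the splitting of the Einstein equations -/

namespace Ansatz

variable {s : ℕ} {A : Ansatz s} {U : Set (Pt s)} {u : Pt s}

/-- The Gauss curvature of the shells of the d-metric. -/
noncomputable def gaussCurvature (A : Ansatz s) (k : Fin (s + 2)) (u : Pt s) : ℝ :=
  if k = 0 then
    -((A.ε 0 * pd (0, 0) (pd (0, 0) A.ψ) u + A.ε 1 * pd (0, 1) (pd (0, 1) A.ψ) u)
      / (2 * Real.exp (A.ψ u)))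
  else -(pd (k, 1) (A.φ k) u * pd (k, 1) (A.h k 0) u / (2 * A.h k 0 u * A.h k 1 u))

variable (hU : IsOpen U) (hA : A.IsAdmissibleOn U)
include hU hA

theorem Γ_zero_shell (i j l : Fin 2) : Set.EqOn (A.Γ (0, i) (0, j) (0, l))
    (fun u => ((if j = i then pd (0, l) A.ψ u else 0) + (if l = i then pd (0, j) A.ψ u else 0)
      - (if j = l then A.ε i * A.ε j * pd (0, i) A.ψ u else 0)) / 2) U := by
  intro u hu
  have hψ := (smoothOf_ψ hA).differentiableAt hU hu
  have hg : ∀ x y : Fin 2, pd (0, x) (A.g (0, y)) u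
      = A.ε y * (Real.exp (A.ψ u) * pd (0, x) A.ψ u) := by
    intro x y
    have : A.g (0, y) = fun u => A.ε y * Real.exp (A.ψ u) := by simp [g]
    rw [this, pd_const_mul _ _ hψ.exp, pd_exp _ hψ]
  have hg0 : A.g (0, i) u = A.ε i * Real.exp (A.ψ u) := by simp [g]
  have h0 := ε_ne_zero hA i
  have h1 := Real.exp_ne_zero (A.ψ u)
  have h2 := ε_sq hA i
  rw [Γ_shell hU hA hu, hg, hg, hg, hg0]
  -- Since `ε_i² = 1`, every term carries the factor `ε_i e^ψ`, which cancels against the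
  -- denominator.
  have h3 : A.ε j * (Real.exp (A.ψ u) * pd (0, i) A.ψ u)
      = A.ε i * (Real.exp (A.ψ u) * (A.ε i * A.ε j * pd (0, i) A.ψ u)) := by
    linear_combination (-(A.ε j * (Real.exp (A.ψ u) * pd (0, i) A.ψ u))) * h2
  rw [h3]
  simp only [← mul_ite_zero, ← mul_add, ← mul_sub]
  field_simp

theorem pd_Γ_zero_shell (hu : u ∈ U) (a : Idx s) (i j l : Fin 2) :
    pd a (A.Γ (0, i) (0, j) (0, l)) u = ((if j = i then pd a (pd (0, l) A.ψ) u else 0)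
      + (if l = i then pd a (pd (0, j) A.ψ) u else 0)
      - (if j = l then A.ε i * A.ε j * pd a (pd (0, i) A.ψ) u else 0)) / 2 := by
  have hd : ∀ b, DifferentiableAt ℝ (pd b A.ψ) u := fun b =>
    ((smoothOf_ψ hA).pd hU b).differentiableAt hU hu
  have key : ∀ (p : Prop) [Decidable p] (f : Field s), DifferentiableAt ℝ f u →
      DifferentiableAt ℝ (fun u => if p then f u else 0) u ∧
      pd a (fun u => if p then f u else 0) u = if p then pd a f u else 0 := by
    intro p _ f hf
    by_cases h : p
    · simpa [h] using hf
    · simp [h, pd_const]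
  obtain ⟨d1, e1⟩ := key (j = i) _ (hd (0, l))
  obtain ⟨d2, e2⟩ := key (l = i) _ (hd (0, j))
  obtain ⟨d3, e3⟩ := key (j = l) _ ((hd (0, i)).const_mul (A.ε i * A.ε j))
  rw [pd_congr hU hu (Γ_zero_shell hU hA i j l), pd_div_const _ _ ((d1.fun_add d2).fun_sub d3),
    pd_sub _ (d1.fun_add d2) d3, pd_add _ d1 d2, e1, e2, e3, pd_const_mul _ _ (hd _)]

/-- The classical curvature of a conformally flat surface: the terms quadratic in `∂ψ` cancel in
dimension two. -/
theorem ricci_zero_shell (hu : u ∈ U) (i j : Fin 2) :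
    A.ricci (0, i) (0, j) u = if i = j then A.gaussCurvature 0 u * A.g (0, i) u else 0 := by
  have he : ∀ a b c d, A.e (0, d) (A.Γ (0, c) (0, b) (0, a)) u
      = pd (0, d) (A.Γ (0, c) (0, b) (0, a)) u := fun a b c d =>
    e_of_eq hU hu ((smoothOf_Γ_shell hU hA 0 c b a).mono (coefVars_subset 0))
  have hW : ∀ a b c, A.W (0, a) (0, b) (0, c) u = 0 := fun a b c => W_shell hU hA hu 0 a b c
  have hcomm := (smoothOf_ψ hA).pd_comm hU hu (0, 1) (0, 0)
  have hg0 : A.g (0, i) u = A.ε i * Real.exp (A.ψ u) := by simp [g]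
  have h0 := ε_sq hA 0
  have h1 := ε_sq hA 1
  have h2 := Real.exp_ne_zero (A.ψ u)
  rw [ricci_eq hU hA hu, hg0, gaussCurvature, if_pos rfl]
  simp only [he, hW, pd_Γ_zero_shell hU hA hu, Γ_zero_shell hU hA _ _ _ hu, Fin.sum_univ_two]
  fin_cases i <;> fin_cases j <;>
    simp only [Fin.zero_eta, Fin.mk_one, Fin.isValue, if_true, one_ne_zero, zero_ne_one, if_false,
      h0, h1, hcomm]
  · field_simp
    linear_combination (2 * pd (0, 0) (pd (0, 0) A.ψ) u) * h0
  · field_simp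
    linear_combination (-(pd (0, 0) A.ψ u * pd (0, 1) A.ψ u * A.ε 1 ^ 2)) * h0
      - pd (0, 0) A.ψ u * pd (0, 1) A.ψ u * h1
  · field_simp
    linear_combination (-(pd (0, 0) A.ψ u * pd (0, 1) A.ψ u * A.ε 1 ^ 2)) * h0
      - pd (0, 0) A.ψ u * pd (0, 1) A.ψ u * h1
  · field_simp
    linear_combination (2 * pd (0, 1) (pd (0, 1) A.ψ) u) * h1

theorem ricci_of_eq (hu : u ∈ U) (k : Fin (s + 2)) (i j : Fin 2) :
    A.ricci (k, i) (k, j) u = if i = j then A.gaussCurvature k u * A.g (k, i) u else 0 := by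
  by_cases hk : k = 0
  · subst hk
    exact ricci_zero_shell hU hA hu i j
  · rw [ricci_shell hU hA hk hu, gaussCurvature, if_neg hk, g_of_ne hk]

theorem scalar_eq (hu : u ∈ U) : A.scalar u = 2 * ∑ k, A.gaussCurvature k u := by
  rw [scalar, Fintype.sum_prod_type, Finset.mul_sum]
  refine Finset.sum_congr rfl fun k _ => ?_
  have : ∀ i : Fin 2, A.ricci (k, i) (k, i) u / A.g (k, i) u = A.gaussCurvature k u := fun i => by
    rw [ricci_of_eq hU hA hu, if_pos rfl, mul_div_assoc, div_self (g_ne_zero hA hu _), mul_one]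
  simp only [this, Fin.sum_univ_two]
  ring

omit hU hA in
/-- The matrix with zeros on the diagonal and ones elsewhere is invertible in size at least 2. -/
theorem forall_sum_erase_eq_zero_iff (x : Fin (s + 2) → ℝ) :
    (∀ k, ∑ j ∈ Finset.univ.erase k, x j = 0) ↔ ∀ k, x k = 0 := by
  refine ⟨fun h => ?_, fun h k => Finset.sum_eq_zero fun j _ => h j⟩
  have h1 : ∀ k, x k = ∑ j, x j := fun k => by
    rw [← Finset.add_sum_erase _ _ (Finset.mem_univ k), h k, add_zero]
  -- Every entry equals the total, so the total is `s + 2` times itself; as `s + 1 ≠ 0`, it is zero.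
  have h2 : ∑ j, x j = (s + 2) * ∑ j, x j := by
    conv_lhs => rw [Finset.sum_congr rfl fun k _ => h1 k]
    simp
  have h3 : ((s : ℝ) + 1) * ∑ j, x j = 0 := by linear_combination -h2
  intro k
  rw [h1 k]
  exact (mul_eq_zero.1 h3).resolve_left (by positivity)

/-- The Einstein equations prescribe the curvature of every shell and annihilate the Ricci
coefficients whose second index is in an earlier shell. -/
theorem einsteinEquationsAt_iff (hu : u ∈ U) : A.EinsteinEquationsAt u ↔
    (∀ k, A.gaussCurvature k u + A.Λ k u = 0) ∧
      ∀ k, ∀ τ : Idx s, τ.1 < k → ∀ i, A.ricci (k, i) τ u = 0 := by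
  have hdiag : ∀ k i, (A.ricci (k, i) (k, i) u - 1 / 2 * A.gm (k, i) (k, i) u * A.scalar u
        = A.gm (k, i) (k, i) u * A.source k u) ↔
      ∑ j ∈ Finset.univ.erase k, (A.gaussCurvature j u + A.Λ j u) = 0 := by
    intro k i
    have hg := g_ne_zero hA hu (k, i)
    rw [ricci_of_eq hU hA hu, if_pos rfl, scalar_eq hU hA hu, gm, if_pos rfl, source,
      ← Finset.add_sum_erase _ (fun k => A.gaussCurvature k u) (Finset.mem_univ k),
      Finset.sum_add_distrib]
    constructor
    · intro h
      refine mul_left_cancel₀ hg ?_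
      linear_combination -h
    · intro h
      linear_combination (-A.g (k, i) u) * h
  have hoff : ∀ a b, a ≠ b → ((A.ricci a b u - 1 / 2 * A.gm a b u * A.scalar u
      = A.gm a b u * A.source b.1 u) ↔ A.ricci a b u = 0) := by
    intro a b hab
    simp [gm, hab]
  rw [← forall_sum_erase_eq_zero_iff]
  constructor
  · intro h
    refine ⟨fun k => (hdiag k 0).1 (h _ _), fun k τ hτ i => (hoff _ _ ?_).1 (h _ _)⟩
    rintro rfl
    exact lt_irrefl _ hτ
  · rintro ⟨h1, h2⟩ ⟨k, i⟩ b
    by_cases hab : (k, i) = b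
    · subst hab
      exact (hdiag k i).2 (h1 k)
    · rw [hoff _ _ hab]
      rcases lt_trichotomy b.1 k with h | h | h
      · exact h2 k b h i
      · obtain ⟨l, j⟩ := b
        obtain rfl : l = k := h
        rw [ricci_of_eq hU hA hu, if_neg (by rintro rfl; exact hab rfl)]
      · exact ricci_of_lt hU hA hu h

/-- The prefactors do not vanish and the frame block is invertible; `β w_τ - α_τ` is a nonzero
multiple of `∂_τ φ - w_τ φ'`. -/
theorem forall_ricci_below_eq_zero_iff (hu : u ∈ U) {k : Fin (s + 2)} (hk : k ≠ 0) :
    (∀ τ : Idx s, τ.1 < k → ∀ i, A.ricci (k, i) τ u = 0) ↔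
      ∀ τ : Idx s, τ.1 < k →
        pd (k, 1) (pd (k, 1) (A.n k τ)) u + A.γ k u * pd (k, 1) (A.n k τ) u = 0 ∧
        A.β k u * A.w k τ u - A.α k τ u = 0 := by
  have h0 := hA.h_ne_zero k hk 0 u hu
  have h1 := hA.h_ne_zero k hk 1 u hu
  have h2 := hA.pd_h_ne_zero k hk u hu
  have hw : ∀ τ : Idx s, A.β k u * A.w k τ u - A.α k τ u = 0 ↔
      pd τ (A.φ k) u - A.w k τ u * pd (k, 1) (A.φ k) u = 0 := by
    intro τ
    have : A.β k u * A.w k τ u - A.α k τ u = -(pd (k, 1) (A.h k 0) u / (2 * A.h k 0 u)) *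
        (pd τ (A.φ k) u - A.w k τ u * pd (k, 1) (A.φ k) u) := by
      rw [α, β]
      ring
    rw [this, mul_eq_zero, or_iff_right]
    exact neg_ne_zero.2 (div_ne_zero h2 (mul_ne_zero two_ne_zero h0))
  have hz := fun (τ : Idx s) (hτ : τ.1 < k) =>
    (Eq.congr_left (ricci_zero_below hU hA hk hu hτ)).trans
      (mul_eq_zero_iff_left (neg_ne_zero.2 (div_ne_zero h0 (mul_ne_zero two_ne_zero h1))))
  have ho := fun (τ : Idx s) (hτ : τ.1 < k) =>
    (Eq.congr_left (ricci_one_below hU hA hk hu hτ)).trans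
      (mul_eq_zero_iff_left (neg_ne_zero.2 (div_ne_zero h2 (mul_ne_zero two_ne_zero h0))))
  simp only [hw, Fin.forall_fin_two, forall_and]
  rw [forall₂_congr hz, forall₂_congr ho, forall_sum_frame_eq_zero_iff A u k fun d =>
      pd (k, 1) (pd (k, 1) (A.n k d)) u + A.γ k u * pd (k, 1) (A.n k d) u,
    forall_sum_frame_eq_zero_iff A u k fun d =>
      pd d (A.φ k) u - A.w k d u * pd (k, 1) (A.φ k) u]

omit hU hA in
theorem gaussCurvature_zero_add_iff :
    A.gaussCurvature 0 u + A.Λ 0 u = 0 ↔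
      A.ε 0 * pd (0, 0) (pd (0, 0) A.ψ) u + A.ε 1 * pd (0, 1) (pd (0, 1) A.ψ) u
        = 2 * (Real.exp (A.ψ u) * A.Λ 0 u) := by
  rw [gaussCurvature, if_pos rfl, neg_add_eq_zero, div_eq_iff (by positivity)]
  constructor <;> intro h <;> linear_combination h

omit hU in
theorem gaussCurvature_add_iff (hu : u ∈ U) {k : Fin (s + 2)} (hk : k ≠ 0) :
    A.gaussCurvature k u + A.Λ k u = 0 ↔
      pd (k, 1) (A.φ k) u * pd (k, 1) (A.h k 0) u = 2 * A.h k 0 u * A.h k 1 u * A.Λ k u := by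
  have h0 := hA.h_ne_zero k hk 0 u hu
  have h1 := hA.h_ne_zero k hk 1 u hu
  rw [gaussCurvature, if_neg hk, neg_add_eq_zero,
    div_eq_iff (mul_ne_zero (mul_ne_zero two_ne_zero h0) h1)]
  constructor <;> intro h <;> linear_combination h

end Ansatz

end JetDecoupling

theorem mainTheorem1 (s : ℕ) (A : JetDecoupling.Ansatz s) (U : Set (JetDecoupling.Pt s))
    (hU : IsOpen U) (hA : A.IsAdmissibleOn U) :
    ∀ u ∈ U,
      A.EinsteinEquationsAt u ↔
        (A.ε 0 * JetDecoupling.pd (0, 0) (JetDecoupling.pd (0, 0) A.ψ) u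
            + A.ε 1 * JetDecoupling.pd (0, 1) (JetDecoupling.pd (0, 1) A.ψ) u
          = 2 * (Real.exp (A.ψ u) * A.Λ 0 u)) ∧
        ∀ k : Fin (s + 2), k ≠ 0 →
          JetDecoupling.pd (k, 1) (A.φ k) u * JetDecoupling.pd (k, 1) (A.h k 0) u
              = 2 * A.h k 0 u * A.h k 1 u * A.Λ k u ∧
          ∀ τ : JetDecoupling.Idx s, τ.1 < k →
            JetDecoupling.pd (k, 1) (JetDecoupling.pd (k, 1) (A.n k τ)) u
                + A.γ k u * JetDecoupling.pd (k, 1) (A.n k τ) u = 0 ∧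
            A.β k u * A.w k τ u - A.α k τ u = 0 := by
  intro u hu
  rw [JetDecoupling.Ansatz.einsteinEquationsAt_iff hU hA hu]
  constructor
  · rintro ⟨h1, h2⟩
    exact ⟨JetDecoupling.Ansatz.gaussCurvature_zero_add_iff.1 (h1 0), fun k hk =>
      ⟨(JetDecoupling.Ansatz.gaussCurvature_add_iff hA hu hk).1 (h1 k),
        (JetDecoupling.Ansatz.forall_ricci_below_eq_zero_iff hU hA hu hk).1 (h2 k)⟩⟩
  · rintro ⟨h1, h2⟩
    refine ⟨fun k => ?_, fun k τ hτ => ?_⟩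
    · by_cases hk : k = 0
      · subst hk
        exact JetDecoupling.Ansatz.gaussCurvature_zero_add_iff.2 h1
      · exact (JetDecoupling.Ansatz.gaussCurvature_add_iff hA hu hk).2 (h2 k hk).1
    · have hk : k ≠ 0 := (lt_of_le_of_lt (Fin.zero_le _) hτ).ne'
      exact (JetDecoupling.Ansatz.forall_ricci_below_eq_zero_iff hU hA hu hk).2 (h2 k hk).2 τ hτ
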